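/- **Theorem (Global distributivity).** Fix an alphabet $\Sigma$. Let $\mathsf{Syn}$ be the free strict symmetric monoidal category (monoidal product $\oplus$, unit $0$, symmetries $\sigma$; composition $;$ in diagrammatic order) on two objects $\blacktriangleright,\blacktriangleleft$ and the morphisms - black nodes: copy $\Delta:\blacktriangleright\to\blacktriangleright\blacktriangleright$, delete $!:\blacktriangleright\to 0$, merge $\nabla:\blacktriangleright\blacktriangleright\to\blacktriangleright$, co-delete $\gamma:0\to\blacktriangleright$; - $\mathrm{cup}:0\to\blacktriangleleft\blacktriangleright$, $\mathrm{cap}:\blacktriangleleft\blacktriangleright\to 0$, and $a:\blacktriangleright\to\blacktriangleright$ for each $a\in\Sigma$; - white nodes: $\mu:\blacktriangleright\blacktriangleright\to\blacktriangleright$, $\upsilon:0\to\blacktriangleright$, $\kappa:\blacktriangleright\to\blacktriangleright\blacktriangleright$, $\omega:\blacktriangleright\to 0$. Write $1$ for the identity of $\blacktriangleright$, $1_2=1\oplus 1$, $s=\sigma_{\blacktriangleright,\blacktriangleright}$, $\chi=1\oplus s\oplus 1$ and $\mathrm{cap}'=\sigma_{\blacktriangleright,\blacktriangleleft};\mathrm{cap}$.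 Let $\le_{\mathrm{KDA}}$ be the smallest family of preorders on the hom-sets of $\mathsf{Syn}$ that is compatible with $;$ and $\oplus$ and contains the following (each equality standing for two inequalities), and let $c=_{\mathrm{KDA}}d$ mean $c\le_{\mathrm{KDA}}d$ and $d\le_{\mathrm{KDA}}c$: - (A) $(1\oplus\mathrm{cup});(\mathrm{cap}'\oplus 1)=1$; $\ (\mathrm{cup}\oplus \mathrm{id}_{\blacktriangleleft});(\mathrm{id}_{\blacktriangleleft}\oplus\mathrm{cap}')=\mathrm{id}_{\blacktriangleleft}$; $\ \mathrm{cup};\mathrm{cap}=\mathrm{id}_0$. - (B) $\Delta;(\Delta\oplus1)=\Delta;(1\oplus\Delta)$; $\ \Delta;(1\oplus !)=1$; $\ \Delta;s=\Delta$; $\ (\nabla\oplus1);\nabla=(1\oplus\nabla);\nabla$; $\ (1\oplus \gamma);\nabla=1$; $\ s;\nabla=\nabla$; $\ \nabla;\Delta=(\Delta\oplus\Delta);\chi;(\nabla\oplus\nabla)$; $\ \gamma;\Delta=\gamma\oplus \gamma$; $\ \nabla;!=!\oplus !$; $\ \Delta;\nabla=1$; $\ \gamma;!=\mathrm{id}_0$;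 $\ (\mathrm{cup}\oplus1);(\mathrm{id}_{\blacktriangleleft}\oplus(\nabla;\Delta));(\mathrm{cap}\oplus1)=1$. - (C) $\kappa;(\kappa\oplus1)=\kappa;(1\oplus\kappa)$; $\ \kappa;(1\oplus\omega)=1$; $\ \kappa;s=\kappa$; $\ (\mu\oplus1);\mu=(1\oplus\mu);\mu$; $\ (1\oplus\upsilon);\mu=1$; $\ s;\mu=\mu$. - (D) $\upsilon;\Delta=\upsilon\oplus\upsilon$; $\ \mu;\Delta=(\Delta\oplus\Delta);\chi;(\mu\oplus\mu)$; $\ \mu;!=!\oplus !$; $\ \gamma;\kappa=\gamma\oplus \gamma$; $\ \nabla;\kappa=(\kappa\oplus\kappa);\chi;(\nabla\oplus\nabla)$; $\ \nabla;\omega=\omega\oplus\omega$. - (E) $\chi;(\nabla\oplus\nabla);\mu\le(\mu\oplus\mu);\nabla$; $\ (\gamma\oplus \gamma);\mu\le \gamma$; $\ \kappa;(\Delta\oplus\Delta);\chi\le\Delta;(\kappa\oplus\kappa)$; $\ \kappa;(!\oplus !)\le !$; and for every $a\in\Sigma$: $a;\Delta=\Delta;(a\oplus a)$, $\ a;!=!$,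 $\ (a\oplus a);\mu=\mu;a$, $\ \upsilon=\upsilon;a$, $\ \nabla;a=(a\oplus a);\nabla$, $\ \gamma;a=\gamma$, $\ \kappa;(a\oplus a)=a;\kappa$, $\ \omega=a;\omega$. - (F) $\nabla;\Delta\le1_2$, $\ 1\le !;\gamma$, $\ 1\le\Delta;\nabla$, $\ \gamma;!\le\mathrm{id}_0$; $\ 1_2\le\mu;\Delta$, $\ !;\upsilon\le1$, $\ \Delta;\mu\le1$, $\ \mathrm{id}_0\le\upsilon;!$; $\ 1_2\le\nabla;\kappa$, $\ \omega;\gamma\le1$, $\ \kappa;\nabla\le1$, $\ \mathrm{id}_0\le \gamma;\omega$. An *automaton-diagram* is a morphism of $\mathsf{Syn}$ built, with $;$ and $\oplus$, from identities, symmetries, the black nodes, $\mathrm{cup}$, $\mathrm{cap}$ and the letters $a\in\Sigma$ only. For $n\in\mathbb N$ let $\Delta_n:\blacktriangleright^n\to\blacktriangleright^n\oplus\blacktriangleright^n$, $\nabla_n:\blacktriangleright^n\oplus\blacktriangleright^n\to\blacktriangleright^n$, $!_n:\blacktriangleright^n\to0$ and $\gamma_n:0\to\blacktriangleright^n$ be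 the wire-by-wire copying, merging, deletion and co-deletion of $n$ wires (the $i$-th wire being copied to, or merged from, the $i$-th wires of the two copies of $\blacktriangleright^n$). Then every automaton-diagram $d:\blacktriangleright^m\to\blacktriangleright^n$ ($m,n\ge 0$) satisfies $$(\mathrm{cpy})\ \ d;\Delta_n=_{\mathrm{KDA}}\Delta_m;(d\oplus d),\qquad(\mathrm{del})\ \ d;!_n=_{\mathrm{KDA}}!_m,$$ $$(\text{co-cpy})\ \ \nabla_m;d=_{\mathrm{KDA}}(d\oplus d);\nabla_n,\qquad(\text{co-del})\ \ \gamma_m;d=_{\mathrm{KDA}}\gamma_n .$$ Consequently, in the category whose objects are the $\blacktriangleright^n$ and whose morphisms $\blacktriangleright^m\to\blacktriangleright^n$ are automaton-diagrams modulo $=_{\mathrm{KDA}}$, the monoidal product is a biproduct: there are zero morphisms; $\blacktriangleright^0$ is a zero object; $\blacktriangleright^m\oplus\blacktriangleright^n$ is a biproduct of $\blacktriangleright^m$ and $\blacktriangleright^n$ with projections $\mathrm{id}\oplus !_n$, $!_m\oplus\mathrm{id}$ and injections $\mathrm{id}\oplus \gamma_n$, $\gamma_m\oplus\mathrm{id}$;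 and these projections and injections are natural, i.e. $f\oplus g$ is the biproduct of the morphisms $f$ and $g$. -/

import Mathlib

open CategoryTheory CategoryTheory.Limits

namespace KDA

/-- The two generating objects, the right-pointing wire `▶` and the left-pointing wire `◀`. -/
inductive Wire : Type
  | right : Wire
  | left : Wire

/-- The right-pointing wire. -/
abbrev rt : Wire := Wire.right

/-- The left-pointing wire. -/
abbrev lt : Wire := Wire.left

/-- The object `▶ⁿ`, a list of `n` right-pointing wires (listed from top to bottom). -/
abbrev rights (n : ℕ) : List Wire := List.replicate n rt

/-- Terms for string diagrams over the alphabet `S`. Objects are lists of wires and the monoidal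
product of objects is list concatenation. The morphisms of the free strict symmetric monoidal
category are these terms modulo `SMCEq` below. -/
inductive Diag (S : Type*) : List Wire → List Wire → Type _
  | id (A : List Wire) : Diag S A A
  | comp {A B C : List Wire} (f : Diag S A B) (g : Diag S B C) : Diag S A C
  | tensor {A B C D : List Wire} (f : Diag S A B) (g : Diag S C D) : Diag S (A ++ C) (B ++ D)
  | swap (A B : List Wire) : Diag S (A ++ B) (B ++ A)
  /-- black comultiplication -/
  | copy : Diag S [rt] [rt, rt]
  /-- black counit -/
  | delete : Diag S [rt] []
  /-- black multiplication -/
  | merge : Diag S [rt, rt] [rt]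
  /-- black unit (co-delete) -/
  | generate : Diag S [] [rt]
  /-- the wire that comes in from the right at the top and leaves to the right at the bottom -/
  | cup : Diag S [] [lt, rt]
  /-- the wire that comes in from the left at the bottom and leaves to the left at the top -/
  | cap : Diag S [lt, rt] []
  /-- the action of a letter -/
  | letter (a : S) : Diag S [rt] [rt]
  /-- white multiplication -/
  | wmult : Diag S [rt, rt] [rt]
  /-- white unit -/
  | wunit : Diag S [] [rt]
  /-- white comultiplication -/
  | wcomult : Diag S [rt] [rt, rt]
  /-- white counit -/
  | wcounit : Diag S [rt] []

/-- Sequential composition, in diagrammatic order. -/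
infixl:65 " ⨾ " => Diag.comp

/-- Parallel composition (monoidal product). -/
infixr:70 " ⊞ " => Diag.tensor

namespace Diag

variable {S : Type*}

/-- Transport of a diagram along equalities of its domain and codomain. -/
def cast {A A' B B' : List Wire} (hA : A = A') (hB : B = B') (f : Diag S A B) : Diag S A' B' :=
  hA ▸ hB ▸ f

/-- The automaton-diagrams: no white generator occurs. -/
def IsAutomaton : {A B : List Wire} → Diag S A B → Prop
  | _, _, id _ => True
  | _, _, comp f g => IsAutomaton f ∧ IsAutomaton g
  | _, _, tensor f g => IsAutomaton f ∧ IsAutomaton g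
  | _, _, swap _ _ => True
  | _, _, copy => True
  | _, _, delete => True
  | _, _, merge => True
  | _, _, generate => True
  | _, _, cup => True
  | _, _, cap => True
  | _, _, letter _ => True
  | _, _, wmult => False
  | _, _, wunit => False
  | _, _, wcomult => False
  | _, _, wcounit => False

/-- The crossing of the two middle wires among four. -/
def mid : Diag S [rt, rt, rt, rt] [rt, rt, rt, rt] :=
  id [rt] ⊞ swap [rt] [rt] ⊞ id [rt]

/-- Copying on `▶ⁿ`: both halves of the codomain receive all `n` inputs in order. -/
def copyN : (n : ℕ) → Diag S (rights n) (rights n ++ rights n)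
  | 0 => id []
  | n + 1 =>
    (copy ⊞ copyN n) ⨾
      cast rfl (congrArg (List.cons rt) (List.append_assoc (rights n) [rt] (rights n)))
        (id [rt] ⊞ swap [rt] (rights n) ⊞ id (rights n))

/-- Deletion on `▶ⁿ`. -/
def deleteN : (n : ℕ) → Diag S (rights n) []
  | 0 => id []
  | n + 1 => delete ⊞ deleteN n

/-- Merging on `▶ⁿ`: the `i`-th wires of the two halves of the domain are merged. -/
def mergeN : (n : ℕ) → Diag S (rights n ++ rights n) (rights n)
  | 0 => id []
  | n + 1 =>
    cast (congrArg (List.cons rt) (List.append_assoc (rights n) [rt] (rights n))) rfl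
        (id [rt] ⊞ swap (rights n) [rt] ⊞ id (rights n)) ⨾
      (merge ⊞ mergeN n)

/-- Generation (co-deletion) on `▶ⁿ`. -/
def generateN : (n : ℕ) → Diag S [] (rights n)
  | 0 => id []
  | n + 1 => generate ⊞ generateN n

/-- The laws of strict symmetric monoidal categories. -/
inductive SMCEq : {A B : List Wire} → Diag S A B → Diag S A B → Prop
  | id_comp {A B : List Wire} (f : Diag S A B) : SMCEq (id A ⨾ f) f
  | comp_id {A B : List Wire} (f : Diag S A B) : SMCEq (f ⨾ id B) f
  | comp_assoc {A B C D : List Wire} (f : Diag S A B) (g : Diag S B C) (h : Diag S C D) :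
      SMCEq ((f ⨾ g) ⨾ h) (f ⨾ (g ⨾ h))
  | tensor_id (A B : List Wire) : SMCEq (id A ⊞ id B) (id (A ++ B))
  | tensor_comp {A B C A' B' C' : List Wire} (f : Diag S A B) (g : Diag S B C)
      (f' : Diag S A' B') (g' : Diag S B' C') :
      SMCEq ((f ⨾ g) ⊞ (f' ⨾ g')) ((f ⊞ f') ⨾ (g ⊞ g'))
  | tensor_assoc {A A' B B' C C' : List Wire} (f : Diag S A A') (g : Diag S B B')
      (h : Diag S C C') :
      SMCEq (cast (List.append_assoc A B C) (List.append_assoc A' B' C') ((f ⊞ g) ⊞ h))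
        (f ⊞ (g ⊞ h))
  | unit_tensor {A B : List Wire} (f : Diag S A B) : SMCEq (id [] ⊞ f) f
  | tensor_unit {A B : List Wire} (f : Diag S A B) :
      SMCEq (cast (List.append_nil A) (List.append_nil B) (f ⊞ id [])) f
  | swap_natural {A A' B B' : List Wire} (f : Diag S A A') (g : Diag S B B') :
      SMCEq ((f ⊞ g) ⨾ swap A' B') (swap A B ⨾ (g ⊞ f))
  | swap_swap (A B : List Wire) : SMCEq (swap A B ⨾ swap B A) (id (A ++ B))
  | swap_unit (A : List Wire) : SMCEq (cast (List.append_nil A) rfl (swap A [])) (id A)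
  | swap_append (A B C : List Wire) :
      SMCEq (swap A (B ++ C))
        (cast (List.append_assoc A B C) (List.append_assoc B A C) (swap A B ⊞ id C) ⨾
          cast rfl (List.append_assoc B C A).symm (id B ⊞ swap A C))

/-- The axioms of Kleene Diagram Algebra that are equalities. -/
inductive AxEq : {A B : List Wire} → Diag S A B → Diag S A B → Prop
  -- compact closed structure; `swap [rt] [lt] ⨾ cap` is the cap with the opposite order of wires
  | A1 : AxEq (A := [rt]) (B := [rt])
      ((id [rt] ⊞ cup) ⨾ ((swap [rt] [lt] ⨾ cap) ⊞ id [rt])) (id [rt])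
  | A2 : AxEq (A := [lt]) (B := [lt])
      ((cup ⊞ id [lt]) ⨾ (id [lt] ⊞ (swap [rt] [lt] ⨾ cap))) (id [lt])
  | A3 : AxEq (cup ⨾ cap) (id [])
  -- black nodes: an idempotent bimonoid with trivial feedback
  | B1 : AxEq (A := [rt]) (B := [rt, rt, rt]) (copy ⨾ (copy ⊞ id [rt])) (copy ⨾ (id [rt] ⊞ copy))
  | B2 : AxEq (A := [rt]) (B := [rt]) (copy ⨾ (id [rt] ⊞ delete)) (id [rt])
  | B3 : AxEq (A := [rt]) (B := [rt, rt]) (copy ⨾ swap [rt] [rt]) copy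
  | B4 : AxEq (A := [rt, rt, rt]) (B := [rt])
      ((merge ⊞ id [rt]) ⨾ merge) ((id [rt] ⊞ merge) ⨾ merge)
  | B5 : AxEq (A := [rt]) (B := [rt]) ((id [rt] ⊞ generate) ⨾ merge) (id [rt])
  | B6 : AxEq (A := [rt, rt]) (B := [rt]) (swap [rt] [rt] ⨾ merge) merge
  | B7 : AxEq (A := [rt, rt]) (B := [rt, rt])
      (merge ⨾ copy) ((copy ⊞ copy) ⨾ mid ⨾ (merge ⊞ merge))
  | B8 : AxEq (A := []) (B := [rt, rt]) (generate ⨾ copy) (generate ⊞ generate)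
  | B9 : AxEq (A := [rt, rt]) (B := []) (merge ⨾ delete) (delete ⊞ delete)
  | B10 : AxEq (copy ⨾ merge) (id [rt])
  | B11 : AxEq (generate ⨾ delete) (id [])
  | B12 : AxEq (A := [rt]) (B := [rt])
      ((cup ⊞ id [rt]) ⨾
        (id [lt] ⊞ (merge ⨾ copy) : Diag S [lt, rt, rt] [lt, rt, rt]) ⨾
        (cap ⊞ id [rt])) (id [rt])
  -- white nodes: a cocommutative comonoid and a commutative monoid
  | C1 : AxEq (A := [rt]) (B := [rt, rt, rt])
      (wcomult ⨾ (wcomult ⊞ id [rt])) (wcomult ⨾ (id [rt] ⊞ wcomult))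
  | C2 : AxEq (A := [rt]) (B := [rt]) (wcomult ⨾ (id [rt] ⊞ wcounit)) (id [rt])
  | C3 : AxEq (A := [rt]) (B := [rt, rt]) (wcomult ⨾ swap [rt] [rt]) wcomult
  | C4 : AxEq (A := [rt, rt, rt]) (B := [rt])
      ((wmult ⊞ id [rt]) ⨾ wmult) ((id [rt] ⊞ wmult) ⨾ wmult)
  | C5 : AxEq (A := [rt]) (B := [rt]) ((id [rt] ⊞ wunit) ⨾ wmult) (id [rt])
  | C6 : AxEq (A := [rt, rt]) (B := [rt]) (swap [rt] [rt] ⨾ wmult) wmult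
  -- the two mixed black and white bimonoids
  | D1 : AxEq (A := []) (B := [rt, rt]) (wunit ⨾ copy) (wunit ⊞ wunit)
  | D2 : AxEq (A := [rt, rt]) (B := [rt, rt])
      (wmult ⨾ copy) ((copy ⊞ copy) ⨾ mid ⨾ (wmult ⊞ wmult))
  | D3 : AxEq (A := [rt, rt]) (B := []) (wmult ⨾ delete) (delete ⊞ delete)
  | D4 : AxEq (A := []) (B := [rt, rt]) (generate ⨾ wcomult) (generate ⊞ generate)
  | D5 : AxEq (A := [rt, rt]) (B := [rt, rt])
      (merge ⨾ wcomult) ((wcomult ⊞ wcomult) ⨾ mid ⨾ (merge ⊞ merge))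
  | D6 : AxEq (A := [rt, rt]) (B := []) (merge ⨾ wcounit) (wcounit ⊞ wcounit)
  -- letters distribute over all nodes
  | E6 (a : S) : AxEq (A := [rt]) (B := [rt, rt])
      (letter a ⨾ copy) (copy ⨾ (letter a ⊞ letter a))
  | E7 (a : S) : AxEq (letter a ⨾ delete) delete
  | E8 (a : S) : AxEq (A := [rt, rt]) (B := [rt])
      ((letter a ⊞ letter a) ⨾ wmult) (wmult ⨾ letter a)
  | E9 (a : S) : AxEq wunit (wunit ⨾ letter a)
  | E10 (a : S) : AxEq (A := [rt, rt]) (B := [rt])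
      (merge ⨾ letter a) ((letter a ⊞ letter a) ⨾ merge)
  | E11 (a : S) : AxEq (generate ⨾ letter a) generate
  | E12 (a : S) : AxEq (A := [rt]) (B := [rt, rt])
      (wcomult ⨾ (letter a ⊞ letter a)) (letter a ⨾ wcomult)
  | E13 (a : S) : AxEq wcounit (letter a ⨾ wcounit)

/-- The axioms of Kleene Diagram Algebra that are proper inequalities. -/
inductive AxLe : {A B : List Wire} → Diag S A B → Diag S A B → Prop
  -- lax distributivity
  | E1 : AxLe (A := [rt, rt, rt, rt]) (B := [rt])
      (mid ⨾ (merge ⊞ merge) ⨾ wmult) ((wmult ⊞ wmult) ⨾ merge)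
  | E2 : AxLe (A := []) (B := [rt]) ((generate ⊞ generate) ⨾ wmult) generate
  | E4 : AxLe (A := [rt]) (B := [rt, rt, rt, rt])
      (wcomult ⨾ (copy ⊞ copy) ⨾ mid) (copy ⨾ (wcomult ⊞ wcomult))
  | E5 : AxLe (A := [rt]) (B := []) (wcomult ⨾ (delete ⊞ delete)) delete
  -- copy is left adjoint to merge, and delete to generate
  | F1 : AxLe (merge ⨾ copy) (id [rt, rt])
  | F2 : AxLe (id [rt]) (delete ⨾ generate)
  | F3 : AxLe (id [rt]) (copy ⨾ merge)
  | F4 : AxLe (generate ⨾ delete) (id [])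
  -- white multiplication is left adjoint to copy, and the white unit to delete
  | F5 : AxLe (id [rt, rt]) (wmult ⨾ copy)
  | F6 : AxLe (delete ⨾ wunit) (id [rt])
  | F7 : AxLe (copy ⨾ wmult) (id [rt])
  | F8 : AxLe (id []) (wunit ⨾ delete)
  -- merge is left adjoint to white comultiplication, and generate to the white counit
  | F9 : AxLe (id [rt, rt]) (merge ⨾ wcomult)
  | F10 : AxLe (wcounit ⨾ generate) (id [rt])
  | F11 : AxLe (wcomult ⨾ merge) (id [rt])
  | F12 : AxLe (id []) (generate ⨾ wcounit)

/-- The order of Kleene Diagram Algebra on diagrams of a given type: the smallest preorder that is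
compatible with both compositions, identifies diagrams that are equal in the free strict symmetric
monoidal category, and contains the axioms. -/
inductive Le : {A B : List Wire} → Diag S A B → Diag S A B → Prop
  | refl {A B : List Wire} (f : Diag S A B) : Le f f
  | trans {A B : List Wire} {f g h : Diag S A B} : Le f g → Le g h → Le f h
  | comp {A B C : List Wire} {f f' : Diag S A B} {g g' : Diag S B C} :
      Le f f' → Le g g' → Le (f ⨾ g) (f' ⨾ g')
  | tensor {A B C D : List Wire} {f f' : Diag S A B} {g g' : Diag S C D} :
      Le f f' → Le g g' → Le (f ⊞ g) (f' ⊞ g')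
  | smc {A B : List Wire} {f g : Diag S A B} : SMCEq f g → Le f g
  | smc_symm {A B : List Wire} {f g : Diag S A B} : SMCEq f g → Le g f
  | eq {A B : List Wire} {f g : Diag S A B} : AxEq f g → Le f g
  | eq_symm {A B : List Wire} {f g : Diag S A B} : AxEq f g → Le g f
  | le {A B : List Wire} {f g : Diag S A B} : AxLe f g → Le f g

/-- Equality of diagrams in Kleene Diagram Algebra. -/
def Eqv {A B : List Wire} (f g : Diag S A B) : Prop := Le f g ∧ Le g f

theorem Eqv.refl {A B : List Wire} (f : Diag S A B) : Eqv f f := ⟨Le.refl f, Le.refl f⟩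

theorem Eqv.symm {A B : List Wire} {f g : Diag S A B} (h : Eqv f g) : Eqv g f := ⟨h.2, h.1⟩

theorem Eqv.trans {A B : List Wire} {f g k : Diag S A B} (h : Eqv f g) (h' : Eqv g k) :
    Eqv f k := ⟨h.1.trans h'.1, h'.2.trans h.2⟩

theorem Eqv.comp {A B C : List Wire} {f f' : Diag S A B} {g g' : Diag S B C} (h : Eqv f f')
    (h' : Eqv g g') : Eqv (f ⨾ g) (f' ⨾ g') := ⟨h.1.comp h'.1, h.2.comp h'.2⟩

theorem Eqv.tensor {A B C D : List Wire} {f f' : Diag S A B} {g g' : Diag S C D} (h : Eqv f f')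
    (h' : Eqv g g') : Eqv (f ⊞ g) (f' ⊞ g') := ⟨h.1.tensor h'.1, h.2.tensor h'.2⟩

theorem Eqv.of_smc {A B : List Wire} {f g : Diag S A B} (h : SMCEq f g) : Eqv f g :=
  ⟨Le.smc h, Le.smc_symm h⟩

theorem Eqv.cast {A A' B B' : List Wire} (hA : A = A') (hB : B = B') {f g : Diag S A B}
    (h : Eqv f g) : Eqv (f.cast hA hB) (g.cast hA hB) := by
  subst hA hB; exact h

theorem IsAutomaton.cast {A A' B B' : List Wire} (hA : A = A') (hB : B = B') {f : Diag S A B}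
    (h : f.IsAutomaton) : (f.cast hA hB).IsAutomaton := by
  subst hA hB; exact h

theorem isAutomaton_deleteN : ∀ n : ℕ, (deleteN n : Diag S _ _).IsAutomaton
  | 0 => trivial
  | n + 1 => ⟨trivial, isAutomaton_deleteN n⟩

theorem isAutomaton_generateN : ∀ n : ℕ, (generateN n : Diag S _ _).IsAutomaton
  | 0 => trivial
  | n + 1 => ⟨trivial, isAutomaton_generateN n⟩

end Diag

/-- The objects of the category of left-to-right automaton-diagrams: `⟨n⟩` stands for `▶ⁿ`. -/
structure LR (S : Type*) where
  n : ℕ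

namespace LR

variable {S : Type*}

/-- The automaton-diagrams of type `▶ᵐ → ▶ⁿ`. -/
abbrev Aut (S : Type*) (m n : ℕ) : Type _ :=
  {d : Diag S (rights m) (rights n) // d.IsAutomaton}

/-- Automaton-diagrams of type `▶ᵐ → ▶ⁿ` are identified when they are equal in Kleene Diagram
Algebra. -/
instance homSetoid (S : Type*) (m n : ℕ) : Setoid (Aut S m n) where
  r d e := Diag.Eqv d.1 e.1
  iseqv := ⟨fun d => .refl d.1, fun h => h.symm, fun h h' => h.trans h'⟩

/-- The category of left-to-right automaton-diagrams modulo Kleene Diagram Algebra. -/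
instance category (S : Type*) : Category (LR S) where
  Hom X Y := Quotient (homSetoid S X.n Y.n)
  id X := Quotient.mk _ ⟨Diag.id _, trivial⟩
  comp {X Y Z} f g := Quotient.map₂
    (fun (d : Aut S X.n Y.n) (e : Aut S Y.n Z.n) => (⟨d.1 ⨾ e.1, ⟨d.2, e.2⟩⟩ : Aut S X.n Z.n))
    (fun _ _ h _ _ h' => Diag.Eqv.comp h h') f g
  id_comp f := by
    induction f using Quotient.inductionOn
    exact Quotient.sound (Diag.Eqv.of_smc (.id_comp _))
  comp_id f := by
    induction f using Quotient.inductionOn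
    exact Quotient.sound (Diag.Eqv.of_smc (.comp_id _))
  assoc f g h := by
    induction f using Quotient.inductionOn
    induction g using Quotient.inductionOn
    induction h using Quotient.inductionOn
    exact Quotient.sound (Diag.Eqv.of_smc (.comp_assoc _ _ _))

/-- The morphism given by an automaton-diagram `▶ᵐ → ▶ⁿ`. -/
def hom {m n : ℕ} (d : Diag S (rights m) (rights n)) (hd : d.IsAutomaton) :
    (⟨m⟩ : LR S) ⟶ ⟨n⟩ :=
  Quotient.mk _ ⟨d, hd⟩

theorem rights_add (m n : ℕ) : rights m ++ rights n = rights (m + n) :=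
  (List.replicate_add m n rt).symm

/-- The monoidal product on objects: `▶ᵐ ⊕ ▶ⁿ = ▶ᵐ⁺ⁿ`. -/
def sum (X Y : LR S) : LR S := ⟨X.n + Y.n⟩

/-- The monoidal product on morphisms, by vertical juxtaposition of diagrams. -/
def sumMap {X Y X' Y' : LR S} (f : X ⟶ Y) (g : X' ⟶ Y') : sum X X' ⟶ sum Y Y' :=
  Quotient.map₂
    (fun (d : Aut S X.n Y.n) (e : Aut S X'.n Y'.n) =>
      (⟨(d.1 ⊞ e.1).cast (rights_add _ _) (rights_add _ _),
        Diag.IsAutomaton.cast _ _ ⟨d.2, e.2⟩⟩ : Aut S (X.n + X'.n) (Y.n + Y'.n)))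
    (fun _ _ h _ _ h' => (Diag.Eqv.tensor h h').cast _ _) f g

/-- First projection: delete the last block of wires. -/
def fst (X Y : LR S) : sum X Y ⟶ X :=
  hom ((Diag.id (rights X.n) ⊞ Diag.deleteN Y.n).cast (rights_add _ _) (List.append_nil _))
    (Diag.IsAutomaton.cast _ _ ⟨trivial, Diag.isAutomaton_deleteN _⟩)

/-- Second projection: delete the first block of wires. -/
def snd (X Y : LR S) : sum X Y ⟶ Y :=
  hom ((Diag.deleteN X.n ⊞ Diag.id (rights Y.n)).cast (rights_add _ _) rfl)
    (Diag.IsAutomaton.cast _ _ ⟨Diag.isAutomaton_deleteN _, trivial⟩)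

/-- First injection: generate the last block of wires. -/
def inl (X Y : LR S) : X ⟶ sum X Y :=
  hom ((Diag.id (rights X.n) ⊞ Diag.generateN Y.n).cast (List.append_nil _) (rights_add _ _))
    (Diag.IsAutomaton.cast _ _ ⟨trivial, Diag.isAutomaton_generateN _⟩)

/-- Second injection: generate the first block of wires. -/
def inr (X Y : LR S) : Y ⟶ sum X Y :=
  hom ((Diag.generateN X.n ⊞ Diag.id (rights Y.n)).cast rfl (rights_add _ _))
    (Diag.IsAutomaton.cast _ _ ⟨Diag.isAutomaton_generateN _, trivial⟩)

end LR

end KDA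

-- Copying, deletion, merging and co-deletion are read as transformations `h : F ⟶ G` between
-- braided monoidal functors on the category of diagrams modulo KDA equality, where each of `F`, `G`
-- is the identity, doubling `A ↦ A ⊗ A`, or the constant functor at the unit. Naturality at the
-- black nodes and the letters is an axiom or a consequence of the (co)monoid laws. The difficulty
-- is `cup` and `cap`: a component on the left-pointing wire is needed, and strict naturality there
-- would force `h` to be invertible.
--
-- Order replaces invertibility. If `r` is right adjoint to `h`, the mate of `r` under the duality
-- serves as the component on the left-pointing wire. Then naturality at `cup` holds up to `r ≫ h ≤
-- 𝟙` and at `cap` up to `𝟙 ≤ h ≫ r`, both in the same direction, so the extension is lax natural on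
-- all automaton-diagrams (`exists_lax_extend`). A left adjoint `l` gives the opposite inequality.
-- The two extensions differ only on left-pointing wires, hence agree on powers of the
-- right-pointing wire, where antisymmetry yields equality (`power_natural`). Each black node has
-- both adjoints: the right adjoint of copy is black and its left adjoint is white, while for merge
-- it is the other way round; likewise for the counit and the unit.
--
-- The biproduct then follows as in Fox's theorem: natural commutative comonoids make the monoidal
-- product cartesian, and natural commutative monoids make it cocartesian.

universe u

/-! ### The symmetric monoidal category of diagrams modulo KDA equality -/

namespace KDA

open MonoidalCategory

/-- The objects of the symmetric monoidal category of diagrams: lists of wires. -/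
def Obj (_ : Type u) : Type := List Wire

namespace Obj

variable {S : Type u}

/-- Diagrams of a given type up to equality in Kleene Diagram Algebra. -/
instance homSetoid (S : Type u) (A B : List Wire) : Setoid (Diag S A B) where
  r := Diag.Eqv
  iseqv := ⟨Diag.Eqv.refl, Diag.Eqv.symm, Diag.Eqv.trans⟩

instance category : Category.{u} (Obj S) where
  Hom A B := Quotient (homSetoid S A B)
  id A := Quotient.mk _ (Diag.id A)
  comp f g := Quotient.map₂ Diag.comp (fun _ _ h _ _ h' => Diag.Eqv.comp h h') f g
  id_comp f := by
    induction f using Quotient.inductionOn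
    exact Quotient.sound (.of_smc (.id_comp _))
  comp_id f := by
    induction f using Quotient.inductionOn
    exact Quotient.sound (.of_smc (.comp_id _))
  assoc f g h := by
    induction f using Quotient.inductionOn
    induction g using Quotient.inductionOn
    induction h using Quotient.inductionOn
    exact Quotient.sound (.of_smc (.comp_assoc _ _ _))

/-- A list of wires as an object. -/
def of (S : Type u) (A : List Wire) : Obj S := A

/-- Concatenation of objects. -/
def append (A B : Obj S) : Obj S := List.append A B

theorem append_assoc (A B C : Obj S) : append (append A B) C = append A (append B C) :=
  List.append_assoc _ _ _

theorem append_nil (A : Obj S) : append A (of S []) = A := List.append_nil _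

/-- The morphism represented by a diagram. -/
def mk {A B : List Wire} (d : Diag S A B) : of S A ⟶ of S B := Quotient.mk _ d

theorem mk_surjective {A B : Obj S} (f : A ⟶ B) :
    ∃ d : Diag S A B, mk d = f := Quotient.exists_rep f

theorem mk_eq_iff {A B : List Wire} {d e : Diag S A B} : mk d = mk e ↔ Diag.Eqv d e :=
  ⟨fun h => Quotient.exact h, fun h => Quotient.sound h⟩

theorem mk_smc {A B : List Wire} {d e : Diag S A B} (h : Diag.SMCEq d e) : mk d = mk e :=
  mk_eq_iff.2 (.of_smc h)

theorem mk_ax {A B : List Wire} {d e : Diag S A B} (h : Diag.AxEq d e) : mk d = mk e :=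
  mk_eq_iff.2 ⟨.eq h, .eq_symm h⟩

theorem mk_id (A : List Wire) : mk (Diag.id A : Diag S A A) = 𝟙 (of S A) := rfl

theorem mk_comp {A B C : List Wire} (f : Diag S A B) (g : Diag S B C) :
    mk (f ⨾ g) = mk f ≫ mk g := rfl

theorem mk_cast {A A' B B' : List Wire} (hA : A = A') (hB : B = B') (f : Diag S A B) :
    mk (f.cast hA hB) =
      eqToHom (congrArg (of S) hA.symm) ≫ mk f ≫ eqToHom (congrArg (of S) hB) := by
  subst hA hB
  simp [Diag.cast]

/-- The monoidal product of morphisms. -/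
def tensorMap {A B C D : Obj S} (f : A ⟶ B) (g : C ⟶ D) :
    append A C ⟶ append B D :=
  Quotient.map₂ Diag.tensor (fun _ _ h _ _ h' => Diag.Eqv.tensor h h') f g

theorem tensorMap_id (A B : Obj S) :
    tensorMap (𝟙 A) (𝟙 B) = 𝟙 (append A B) := mk_smc (.tensor_id _ _)

theorem tensorMap_comp {A B C A' B' C' : Obj S} (f : A ⟶ B) (g : B ⟶ C) (f' : A' ⟶ B')
    (g' : B' ⟶ C') : tensorMap (f ≫ g) (f' ≫ g') = tensorMap f f' ≫ tensorMap g g' := by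
  obtain ⟨f, rfl⟩ := mk_surjective f
  obtain ⟨g, rfl⟩ := mk_surjective g
  obtain ⟨f', rfl⟩ := mk_surjective f'
  obtain ⟨g', rfl⟩ := mk_surjective g'
  exact mk_smc (.tensor_comp _ _ _ _)

theorem tensorMap_eqToHom {A B C D : Obj S} (h : A = B) (h' : C = D) :
    tensorMap (eqToHom h) (eqToHom h') =
      eqToHom (congrArg₂ append h h') := by
  subst h h'
  exact tensorMap_id _ _

/-- Concatenation is definitionally left unital, but associative and right unital only
propositionally; hence `Iso.refl` in one case and `eqToIso` in the other two. -/
instance monoidalStruct : MonoidalCategoryStruct (Obj S) where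
  tensorObj A B := append A B
  tensorUnit := of S []
  tensorHom f g := tensorMap f g
  whiskerLeft A _ _ g := tensorMap (𝟙 A) g
  whiskerRight f B := tensorMap f (𝟙 B)
  associator A B C := eqToIso (append_assoc A B C)
  leftUnitor A := Iso.refl A
  rightUnitor A := eqToIso (append_nil A)

theorem leftUnitor_hom_eq (A : Obj S) : (λ_ A).hom = 𝟙 A := rfl

theorem mk_tensor {A B C D : List Wire} (f : Diag S A B) (g : Diag S C D) :
    mk (f ⊞ g) = mk f ⊗ₘ mk g := rfl

/-- Turns a strict law, stated with `cast`, into the naturality square of a structural isomorphism.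
-/
theorem eqToHom_comp_heq_iff {A A' B B' : List Wire} (hA : A = A') (hB : B = B')
    (f : Diag S A B) (g : Diag S A' B') (h : Diag.SMCEq (f.cast hA hB) g) :
    mk f ≫ eqToHom (congrArg (of S) hB) = eqToHom (congrArg (of S) hA) ≫ mk g := by
  rw [← mk_smc h]
  subst hA hB
  simp [Diag.cast]

instance monoidal : MonoidalCategory (Obj S) :=
  MonoidalCategory.ofTensorHom
    (id_tensorHom_id := fun A B => tensorMap_id A B)
    (id_tensorHom := fun _ _ _ _ => rfl)
    (tensorHom_id := fun _ _ => rfl)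
    (tensorHom_comp_tensorHom := fun f₁ f₂ g₁ g₂ => (tensorMap_comp f₁ g₁ f₂ g₂).symm)
    (associator_naturality := fun f g h => by
      obtain ⟨f, rfl⟩ := mk_surjective f
      obtain ⟨g, rfl⟩ := mk_surjective g
      obtain ⟨h, rfl⟩ := mk_surjective h
      exact eqToHom_comp_heq_iff _ _ _ _ (.tensor_assoc f g h))
    (leftUnitor_naturality := fun f => by
      obtain ⟨f, rfl⟩ := mk_surjective f
      exact eqToHom_comp_heq_iff rfl rfl _ _ (.unit_tensor f))
    (rightUnitor_naturality := fun f => by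
      obtain ⟨f, rfl⟩ := mk_surjective f
      exact eqToHom_comp_heq_iff _ _ _ _ (.tensor_unit f))
    (pentagon := fun A B C D => by
      change tensorMap (eqToHom (append_assoc A B C)) (eqToHom rfl) ≫ eqToHom (append_assoc _ _ _) ≫
        tensorMap (eqToHom rfl) (eqToHom (append_assoc B C D)) =
          eqToHom (append_assoc _ _ _) ≫ eqToHom (append_assoc _ _ _)
      rw [tensorMap_eqToHom, tensorMap_eqToHom, eqToHom_trans, eqToHom_trans, eqToHom_trans])
    (triangle := fun A B => by
      change eqToHom (append_assoc A (of S []) B) ≫ tensorMap (eqToHom rfl) (eqToHom rfl) =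
        tensorMap (eqToHom (append_nil A)) (eqToHom rfl)
      rw [tensorMap_eqToHom, tensorMap_eqToHom, eqToHom_trans]
      rfl)

/-- The symmetry. -/
def swapIso (A B : Obj S) : A ⊗ B ≅ B ⊗ A where
  hom := mk (Diag.swap A B)
  inv := mk (Diag.swap B A)
  hom_inv_id := mk_smc (.swap_swap _ _)
  inv_hom_id := mk_smc (.swap_swap _ _)

theorem swapIso_naturality {A A' B B' : Obj S} (f : A ⟶ A') (g : B ⟶ B') :
    (f ⊗ₘ g) ≫ (swapIso A' B').hom = (swapIso A B).hom ≫ (g ⊗ₘ f) := by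
  obtain ⟨f, rfl⟩ := mk_surjective f
  obtain ⟨g, rfl⟩ := mk_surjective g
  exact mk_smc (.swap_natural f g)

/-- This is `swap_append` with its casts read as associators. -/
theorem swapIso_hexagon (A B C : Obj S) :
    (α_ A B C).hom ≫ (swapIso A (B ⊗ C)).hom ≫ (α_ B C A).hom =
      ((swapIso A B).hom ▷ C) ≫ (α_ B A C).hom ≫ (B ◁ (swapIso A C).hom) := by
  have h : (swapIso A (B ⊗ C)).hom = (α_ A B C).inv ≫ ((swapIso A B).hom ▷ C) ≫
      (α_ B A C).hom ≫ (B ◁ (swapIso A C).hom) ≫ (α_ B C A).inv := by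
    refine (mk_smc (.swap_append A B C)).trans ?_
    rw [mk_comp, mk_cast, mk_cast]
    simp only [Category.assoc, eqToHom_refl, Category.id_comp]
    rfl
  simp [h]

instance symmetric : SymmetricCategory (Obj S) where
  braiding := swapIso
  braiding_naturality_right A _ _ f := by
    simpa using swapIso_naturality (𝟙 A) f
  braiding_naturality_left f A := by
    simpa using swapIso_naturality f (𝟙 A)
  hexagon_forward := swapIso_hexagon
  hexagon_reverse A B C := by
    -- The inverse of a swap is a swap, so inverting one hexagon gives the other.
    have h := IsIso.inv_eq_inv.2 (swapIso_hexagon C A B)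
    have e : ∀ A B : Obj S, (swapIso A B).inv = (swapIso B A).hom := fun _ _ => rfl
    simpa [e] using h
  symmetry A B := (swapIso A B).hom_inv_id

/-- The order of Kleene Diagram Algebra on morphisms. -/
def HomLe {A B : Obj S} (f g : A ⟶ B) : Prop :=
  Quotient.liftOn₂ f g Diag.Le fun _ _ _ _ h h' =>
    propext ⟨fun k => h.2.trans (k.trans h'.1), fun k => h.1.trans (k.trans h'.2)⟩

theorem HomLe.antisymm {A B : Obj S} {f g : A ⟶ B} (h : HomLe f g) (h' : HomLe g f) : f = g := by
  obtain ⟨f, rfl⟩ := mk_surjective f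
  obtain ⟨g, rfl⟩ := mk_surjective g
  exact mk_eq_iff.2 ⟨h, h'⟩

end Obj

/-! ### Components of monoidal transformations, and mates -/

open Functor.LaxMonoidal (ε μ)
open Functor.OplaxMonoidal (η δ)

/-- The image of an exact pairing under a monoidal functor. -/
@[reducible]
def exactPairingMap {C D : Type*} [Category* C] [Category* D] [MonoidalCategory C]
    [MonoidalCategory D] (F : C ⥤ D) [F.Monoidal] (X Y : C) [ExactPairing X Y] :
    ExactPairing (F.obj X) (F.obj Y) where
  coevaluation' := ε F ≫ F.map (η_ X Y) ≫ δ F X Y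
  evaluation' := μ F Y X ≫ F.map (ε_ X Y) ≫ η F
  coevaluation_evaluation' := by
    have h : μ F Y (𝟙_ C) ≫ F.map (Y ◁ η_ X Y) ≫ F.map (α_ Y X Y).inv ≫ F.map (ε_ X Y ▷ Y) ≫
        δ F (𝟙_ C) Y = μ F Y (𝟙_ C) ≫ F.map (ρ_ Y).hom ≫ F.map (λ_ Y).inv ≫ δ F (𝟙_ C) Y := by
      have := congrArg F.map (ExactPairing.coevaluation_evaluation X Y)
      simp only [Functor.map_comp] at this
      simp only [← reassoc_of% this]
    have h' := congrArg (fun f => F.obj Y ◁ ε F ≫ f ≫ η F ▷ F.obj Y) h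
    simp only [Category.assoc] at h'
    simp only [comp_whiskerRight, MonoidalCategory.whiskerLeft_comp, Category.assoc]
    rw [← Functor.LaxMonoidal.right_unitality_assoc, Functor.Monoidal.map_leftUnitor_inv] at h'
    simp only [Functor.Monoidal.map_associator_inv, Functor.Monoidal.map_whiskerLeft,
      Functor.Monoidal.map_whiskerRight, Category.assoc, Functor.Monoidal.μ_δ_assoc,
      Category.comp_id, Functor.Monoidal.whiskerRight_ε_η] at h'
    exact h'
  evaluation_coevaluation' := by
    have h : μ F (𝟙_ C) X ≫ F.map (η_ X Y ▷ X) ≫ F.map (α_ X Y X).hom ≫ F.map (X ◁ ε_ X Y) ≫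
        δ F X (𝟙_ C) = μ F (𝟙_ C) X ≫ F.map (λ_ X).hom ≫ F.map (ρ_ X).inv ≫ δ F X (𝟙_ C) := by
      have := congrArg F.map (ExactPairing.evaluation_coevaluation X Y)
      simp only [Functor.map_comp] at this
      simp only [← reassoc_of% this]
    have h' := congrArg (fun f => ε F ▷ F.obj X ≫ f ≫ F.obj X ◁ η F) h
    simp only [Category.assoc] at h'
    simp only [comp_whiskerRight, MonoidalCategory.whiskerLeft_comp, Category.assoc]
    rw [← Functor.LaxMonoidal.left_unitality_assoc, Functor.Monoidal.map_rightUnitor_inv] at h'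
    simp only [Functor.Monoidal.map_associator, Functor.Monoidal.map_whiskerLeft,
      Functor.Monoidal.map_whiskerRight, Category.assoc, Functor.Monoidal.μ_δ_assoc,
      Category.comp_id, Functor.Monoidal.whiskerLeft_ε_η] at h'
    exact h'

section conj

variable {C D : Type*} [Category* C] [Category* D] [MonoidalCategory C] [MonoidalCategory D]
  (F G : C ⥤ D) [F.Monoidal] [G.Monoidal]

/-- The component at a monoidal product of a monoidal transformation with given components. -/
def conj {A B : C} (f : F.obj A ⟶ G.obj A) (g : F.obj B ⟶ G.obj B) :
    F.obj (A ⊗ B) ⟶ G.obj (A ⊗ B) := δ F A B ≫ (f ⊗ₘ g) ≫ μ G A B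

/-- With the two unit laws below, this makes the extension of components from single wires to lists
independent of bracketing. -/
theorem conj_assoc {A B E : C} (f : F.obj A ⟶ G.obj A) (g : F.obj B ⟶ G.obj B)
    (h : F.obj E ⟶ G.obj E) : conj F G (conj F G f g) h ≫ G.map (α_ A B E).hom =
      F.map (α_ A B E).hom ≫ conj F G f (conj F G g h) := by
  have h₁ : conj F G (conj F G f g) h = δ F (A ⊗ B) E ≫ δ F A B ▷ F.obj E ≫ ((f ⊗ₘ g) ⊗ₘ h) ≫
      μ G A B ▷ G.obj E ≫ μ G (A ⊗ B) E := by
    simp only [conj, ← tensorHom_id, tensorHom_comp_tensorHom_assoc, Category.id_comp,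
      Category.comp_id]
  have h₂ : conj F G f (conj F G g h) = δ F A (B ⊗ E) ≫ F.obj A ◁ δ F B E ≫ (f ⊗ₘ g ⊗ₘ h) ≫
      G.obj A ◁ μ G B E ≫ μ G A (B ⊗ E) := by
    simp only [conj, ← id_tensorHom, tensorHom_comp_tensorHom_assoc, Category.id_comp,
      Category.comp_id]
  rw [h₁, h₂]
  simp only [Category.assoc, Functor.LaxMonoidal.associativity, associator_naturality_assoc]
  rw [Functor.OplaxMonoidal.associativity_assoc]

theorem conj_unit_left {A : C} (f : F.obj A ⟶ G.obj A) :
    conj F G (η F ≫ ε G) f ≫ G.map (λ_ A).hom = F.map (λ_ A).hom ≫ f := by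
  simp [conj, MonoidalCategory.tensorHom_def', -Functor.LaxMonoidal.left_unitality,
    whisker_exchange_assoc]

theorem conj_unit_right {A : C} (f : F.obj A ⟶ G.obj A) :
    conj F G f (η F ≫ ε G) ≫ G.map (ρ_ A).hom = F.map (ρ_ A).hom ≫ f := by
  simp [conj, MonoidalCategory.tensorHom_def, -Functor.LaxMonoidal.right_unitality,
    ← whisker_exchange_assoc]

theorem conj_map {A B A' B' : C} (f : F.obj A ⟶ G.obj A) (g : F.obj B ⟶ G.obj B) (a : A' ⟶ A)
    (b : B' ⟶ B) : F.map (a ⊗ₘ b) ≫ conj F G f g =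
      δ F A' B' ≫ ((F.map a ≫ f) ⊗ₘ (F.map b ≫ g)) ≫ μ G A B := by
  simp only [conj, ← tensorHom_comp_tensorHom, Category.assoc,
    Functor.OplaxMonoidal.δ_natural_assoc]

theorem map_conj {A B A' B' : C} (f : F.obj A ⟶ G.obj A) (g : F.obj B ⟶ G.obj B) (a : A ⟶ A')
    (b : B ⟶ B') : conj F G f g ≫ G.map (a ⊗ₘ b) =
      δ F A B ≫ ((f ≫ G.map a) ⊗ₘ (g ≫ G.map b)) ≫ μ G A' B' := by
  simp only [conj, ← tensorHom_comp_tensorHom, Category.assoc, Functor.LaxMonoidal.μ_natural]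

theorem conj_braiding [BraidedCategory C] [BraidedCategory D] {F G : C ⥤ D} [F.Braided]
    [G.Braided] {A B : C} (f : F.obj A ⟶ G.obj A) (g : F.obj B ⟶ G.obj B) :
    F.map (β_ A B).hom ≫ conj F G g f = conj F G f g ≫ G.map (β_ A B).hom := by
  simp [conj, Functor.map_braiding]

/-- Monoidal functors preserve duals, so `r` has a mate `ᘁr` in the direction required of a
component at `X`. Sliding it around the coevaluation or evaluation turns it back into `r`; the
defect from naturality is exactly `r ≫ h` at the coevaluation and `h ≫ r` at the evaluation. -/
theorem exists_mate (X Y : C) [ExactPairing X Y] (r : G.obj Y ⟶ F.obj Y) :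
    ∃ k : F.obj X ⟶ G.obj X, ∀ h : F.obj Y ⟶ G.obj Y,
      F.map (η_ X Y) ≫ conj F G k h =
        η F ≫ ε G ≫ G.map (η_ X Y) ≫ δ G X Y ≫ (G.obj X ◁ (r ≫ h)) ≫ μ G X Y ∧
      conj F G h k ≫ G.map (ε_ X Y) =
        δ F Y X ≫ ((h ≫ r) ▷ F.obj X) ≫ μ F Y X ≫ F.map (ε_ X Y) ≫ η F ≫ ε G := by
  let := exactPairingMap F X Y
  let := exactPairingMap G X Y
  let hF : HasLeftDual (F.obj Y) := ⟨F.obj X⟩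
  let hG : HasLeftDual (G.obj Y) := ⟨G.obj X⟩
  have h₁ : (ε F ≫ F.map (η_ X Y) ≫ δ F X Y) ≫ ((ᘁr) ▷ F.obj Y) =
      (ε G ≫ G.map (η_ X Y) ≫ δ G X Y) ≫ (G.obj X ◁ r) := coevaluation_comp_leftAdjointMate r
  have h₂ : (G.obj Y ◁ (ᘁr)) ≫ μ G Y X ≫ G.map (ε_ X Y) ≫ η G =
      (r ▷ F.obj X) ≫ μ F Y X ≫ F.map (ε_ X Y) ≫ η F := leftAdjointMate_comp_evaluation r
  refine ⟨ᘁr, fun h => ⟨?_, ?_⟩⟩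
  · have := congrArg (fun f => η F ≫ f ≫ (G.obj X ◁ h) ≫ μ G X Y) h₁
    simp only [Category.assoc, Functor.Monoidal.η_ε_assoc] at this
    simpa [conj, MonoidalCategory.tensorHom_def] using this
  · have := congrArg (fun f => δ F Y X ≫ (h ▷ F.obj X) ≫ f ≫ ε G) h₂
    simp only [Category.assoc, Functor.Monoidal.η_ε, Category.comp_id] at this
    simpa [conj, MonoidalCategory.tensorHom_def] using this

end conj

/-! ### Lax extension of a component along compatible preorders -/

section

variable {C : Type*} [Category* C] [MonoidalCategory C]

/-- A preorder on the morphisms of a monoidal category that is compatible with composition and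
with the monoidal product. -/
structure IsMonoidalPreorder (R : ∀ ⦃A B : C⦄, (A ⟶ B) → (A ⟶ B) → Prop) : Prop where
  refl {A B : C} (f : A ⟶ B) : R f f
  trans {A B : C} {f g h : A ⟶ B} : R f g → R g h → R f h
  comp {A B D : C} {f f' : A ⟶ B} {g g' : B ⟶ D} : R f f' → R g g' → R (f ≫ g) (f' ≫ g')
  tensor {A B A' B' : C} {f f' : A ⟶ B} {g g' : A' ⟶ B'} :
    R f f' → R g g' → R (f ⊗ₘ g) (f' ⊗ₘ g')

/-- Reversal of the order lets the case of a left adjoint reuse the argument for a right adjoint. -/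
theorem IsMonoidalPreorder.swap {R : ∀ ⦃A B : C⦄, (A ⟶ B) → (A ⟶ B) → Prop}
    (hR : IsMonoidalPreorder R) : IsMonoidalPreorder (fun _ _ f g => R g f) where
  refl := hR.refl
  trans h h' := hR.trans h' h
  comp h h' := hR.comp h h'
  tensor h h' := hR.tensor h h'

end

namespace Obj

variable {S : Type u}

theorem associator_singleton (w : Wire) (A B : Obj S) : (α_ (of S [w]) A B).hom = 𝟙 _ := rfl

theorem isMonoidalPreorder_homLe : IsMonoidalPreorder (C := Obj S) (fun _ _ => HomLe) where
  refl f := by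
    obtain ⟨f, rfl⟩ := mk_surjective f
    exact Diag.Le.refl f
  trans {_ _ f g h} := by
    obtain ⟨f, rfl⟩ := mk_surjective f
    obtain ⟨g, rfl⟩ := mk_surjective g
    obtain ⟨h, rfl⟩ := mk_surjective h
    exact Diag.Le.trans
  comp {_ _ _ f f' g g'} := by
    obtain ⟨f, rfl⟩ := mk_surjective f
    obtain ⟨g, rfl⟩ := mk_surjective g
    obtain ⟨f', rfl⟩ := mk_surjective f'
    obtain ⟨g', rfl⟩ := mk_surjective g'
    exact Diag.Le.comp
  tensor {_ _ _ _ f f' g g'} := by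
    obtain ⟨f, rfl⟩ := mk_surjective f
    obtain ⟨g, rfl⟩ := mk_surjective g
    obtain ⟨f', rfl⟩ := mk_surjective f'
    obtain ⟨g', rfl⟩ := mk_surjective g'
    exact Diag.Le.tensor

section extend

variable (F G : Obj S ⥤ Obj S) [F.Monoidal] [G.Monoidal]
  (h : ∀ w : Wire, F.obj (of S [w]) ⟶ G.obj (of S [w]))

/-- The monoidal extension to all lists of wires of a family of morphisms indexed by wires. -/
def extend : (A : List Wire) → (F.obj (of S A) ⟶ G.obj (of S A))
  | [] => η F ≫ ε G
  | w :: A => conj F G (A := of S [w]) (B := of S A) (h w) (extend A)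

theorem extend_cons (w : Wire) (A : List Wire) :
    extend F G h (w :: A) = conj F G (A := of S [w]) (B := of S A) (h w) (extend F G h A) := rfl

/-- The recursion ends in the unit component, which right unitality absorbs. -/
theorem extend_singleton (w : Wire) : extend F G h [w] = h w := by
  have e := conj_unit_right F G (h w)
  have e' : (ρ_ (of S [w])).hom = 𝟙 _ := rfl
  erw [e', F.map_id, G.map_id, Category.comp_id, Category.id_comp] at e
  exact e

theorem extend_append (A B : List Wire) : extend F G h (A ++ B) =
    conj F G (A := of S A) (B := of S B) (extend F G h A) (extend F G h B) := by
  induction A with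
  | nil =>
    have e := conj_unit_left F G (extend F G h B)
    erw [leftUnitor_hom_eq, F.map_id, G.map_id, Category.comp_id, Category.id_comp] at e
    exact e.symm
  | cons w A ih =>
    have e := conj_assoc F G (h w) (extend F G h A) (extend F G h B)
    erw [associator_singleton, F.map_id, G.map_id, Category.comp_id, Category.id_comp] at e
    exact (congrArg (conj F G (h w)) ih).trans e.symm

/-- The monoidal extension to powers of the right-pointing wire. -/
def power (h : F.obj (of S [rt]) ⟶ G.obj (of S [rt])) :
    (n : ℕ) → (F.obj (of S (rights n)) ⟶ G.obj (of S (rights n)))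
  | 0 => η F ≫ ε G
  | n + 1 => conj F G (A := of S [rt]) (B := of S (rights n)) h (power h n)

/-- Only the value at `rt` matters here; this is why extensions with different left-pointing
components can be compared. -/
theorem extend_rights (n : ℕ) : extend F G h (rights n) = power F G (h rt) n := by
  induction n with
  | zero => rfl
  | succ n ih => exact congrArg (conj F G (h rt)) ih

end extend

/-- The morphism of the black comultiplication. -/
def copyHom (S : Type u) : of S [rt] ⟶ of S [rt] ⊗ of S [rt] := mk Diag.copy

/-- The morphism of the black counit. -/
def deleteHom (S : Type u) : of S [rt] ⟶ 𝟙_ (Obj S) := mk Diag.delete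

/-- The morphism of the black multiplication. -/
def mergeHom (S : Type u) : of S [rt] ⊗ of S [rt] ⟶ of S [rt] := mk Diag.merge

/-- The morphism of the black unit. -/
def generateHom (S : Type u) : 𝟙_ (Obj S) ⟶ of S [rt] := mk Diag.generate

/-- The exact pairing between the left-pointing and the right-pointing wire. -/
instance exactPairing : ExactPairing (of S [lt]) (of S [rt]) where
  coevaluation' := mk Diag.cup
  evaluation' := mk (Diag.swap [rt] [lt] ⨾ Diag.cap)
  coevaluation_evaluation' := by
    have h := mk_ax (Diag.AxEq.A1 (S := S))
    refine Eq.trans ?_ (h.trans (Category.id_comp (𝟙 (of S [rt]))).symm)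
    -- The associator in the triangle identity is an identity on these lists.
    exact congrArg (fun f => _ ≫ f) (Category.id_comp _)
  evaluation_coevaluation' := by
    have h := mk_ax (Diag.AxEq.A2 (S := S))
    refine Eq.trans ?_ (h.trans (Category.id_comp (𝟙 (of S [lt]))).symm)
    exact congrArg (fun f => _ ≫ f) (Category.id_comp _)

theorem coevaluation_eq : η_ (of S [lt]) (of S [rt]) = mk Diag.cup := rfl

/-- The evaluation is the cap preceded by a crossing; a second crossing cancels it. -/
theorem braiding_evaluation :
    (β_ (of S [lt]) (of S [rt])).hom ≫ ε_ (of S [lt]) (of S [rt]) = mk Diag.cap := by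
  have h : ε_ (of S [lt]) (of S [rt]) = (β_ (of S [rt]) (of S [lt])).hom ≫ mk Diag.cap := rfl
  rw [h]
  exact SymmetricCategory.symmetry_assoc (of S [lt]) (of S [rt]) _

section

variable (F G : Obj S ⥤ Obj S) [F.Braided] [G.Braided]

/-- Naturality at the generators on right-pointing wires. -/
structure IsNaturalOnGenerators (h : F.obj (of S [rt]) ⟶ G.obj (of S [rt])) : Prop where
  copy : F.map (copyHom S) ≫ conj F G h h = h ≫ G.map (copyHom S)
  delete : F.map (deleteHom S) ≫ η F ≫ ε G = h ≫ G.map (deleteHom S)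
  merge : F.map (mergeHom S) ≫ h = conj F G h h ≫ G.map (mergeHom S)
  generate : F.map (generateHom S) ≫ h = (η F ≫ ε G) ≫ G.map (generateHom S)
  letter (a : S) : F.map (mk (Diag.letter a)) ≫ h = h ≫ G.map (mk (Diag.letter a))

variable {F G} {R : ∀ ⦃A B : Obj S⦄, (A ⟶ B) → (A ⟶ B) → Prop}
  {h : F.obj (of S [rt]) ⟶ G.obj (of S [rt])}

/-- Induction on diagrams: lax squares paste along both compositions, the swap is handled by
braidedness, and the only generators giving proper inequalities are `cup` and `cap`, through `h₁`
and `h₂` respectively. -/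
theorem exists_lax_extend (H : IsNaturalOnGenerators F G h)
    (hR : IsMonoidalPreorder R) (r : G.obj (of S [rt]) ⟶ F.obj (of S [rt]))
    (h₁ : R (r ≫ h) (𝟙 _)) (h₂ : R (𝟙 _) (h ≫ r)) :
    ∃ e : ∀ w : Wire, F.obj (of S [w]) ⟶ G.obj (of S [w]), e rt = h ∧
      ∀ {A B : List Wire} (d : Diag S A B), d.IsAutomaton →
        R (F.map (mk d) ≫ extend F G e B) (extend F G e A ≫ G.map (mk d)) := by
  obtain ⟨k, hk⟩ := exists_mate F G (of S [lt]) (of S [rt]) r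
  obtain ⟨k₁, k₂⟩ := hk h
  let e : ∀ w : Wire, F.obj (of S [w]) ⟶ G.obj (of S [w]) := fun w => Wire.rec h k w
  have e₁ : extend F G e [rt] = h := extend_singleton F G e rt
  have e₂ : extend F G e [rt, rt] = conj F G (A := of S [rt]) (B := of S [rt]) h h := by
    rw [extend_cons, e₁]
  have e₃ : extend F G e [lt, rt] = conj F G (A := of S [lt]) (B := of S [rt]) k h := by
    rw [extend_cons, e₁]
  have req : ∀ {A B : Obj S} {f g : A ⟶ B}, f = g → R f g := fun e => e ▸ hR.refl _
  refine ⟨e, rfl, fun d hd => ?_⟩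
  induction d with
  | id A => exact req (by simp [mk_id])
  | comp f g ihf ihg =>
    have i₁ := hR.comp (hR.refl (F.map (mk f))) (ihg hd.2)
    have i₂ := hR.comp (ihf hd.1) (hR.refl (G.map (mk g)))
    simp only [Category.assoc] at i₁ i₂
    simp only [mk_comp, Functor.map_comp, Category.assoc]
    exact hR.trans i₁ i₂
  | tensor f g ihf ihg =>
    rw [extend_append, extend_append, mk_tensor]
    erw [conj_map, map_conj]
    exact hR.comp (hR.refl _) (hR.comp (hR.tensor (ihf hd.1) (ihg hd.2)) (hR.refl _))
  | swap A B =>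
    rw [extend_append, extend_append]
    exact req (conj_braiding (F := F) (G := G) (extend F G e A) (extend F G e B))
  | copy => exact req (by rw [e₁, e₂]; exact H.copy)
  | delete => exact req (by rw [e₁]; exact H.delete)
  | merge => exact req (by rw [e₁, e₂]; exact H.merge)
  | generate => exact req (by rw [e₁]; exact H.generate)
  | letter a => exact req (by rw [e₁]; exact H.letter a)
  | cup =>
    rw [e₃, ← coevaluation_eq]
    change R (F.map _ ≫ conj F G k h) ((η F ≫ ε G) ≫ G.map _)
    have i := hR.comp (hR.refl (η F ≫ ε G ≫ G.map (η_ _ _) ≫ δ G _ _))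
      (hR.comp (hR.tensor (hR.refl (𝟙 (G.obj (of S [lt])))) h₁) (hR.refl (μ G _ _)))
    simpa [k₁] using i
  | cap =>
    rw [e₃, ← braiding_evaluation]
    change R (F.map _ ≫ η F ≫ ε G) (conj F G k h ≫ G.map _)
    have i := hR.comp (hR.refl (F.map (β_ (of S [lt]) (of S [rt])).hom ≫ δ F _ _))
      (hR.comp (hR.tensor h₂ (hR.refl (𝟙 (F.obj (of S [lt])))))
        (hR.refl (μ F _ _ ≫ F.map (ε_ _ _) ≫ η F ≫ ε G)))
    -- The mate formula concerns the evaluation, whose wires are in the opposite order to those of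
    -- `cap`; the braiding is moved across first.
    have j : conj F G k h ≫ G.map ((β_ (of S [lt]) (of S [rt])).hom ≫ ε_ _ _) =
        F.map (β_ (of S [lt]) (of S [rt])).hom ≫ conj F G h k ≫ G.map (ε_ _ _) := by
      rw [G.map_comp, ← Category.assoc, ← conj_braiding, Category.assoc]
    rw [j, k₂]
    simpa using i
  -- Only the white generators remain.
  | _ => exact hd.elim

/-- The right adjoint `r` gives one inequality and the left adjoint `l` the other. Their
left-pointing components differ, but neither is seen by a diagram whose endpoints are
right-pointing. -/
theorem power_natural (H : IsNaturalOnGenerators F G h)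
    (r l : G.obj (of S [rt]) ⟶ F.obj (of S [rt]))
    (r₁ : HomLe (r ≫ h) (𝟙 _)) (r₂ : HomLe (𝟙 _) (h ≫ r))
    (l₁ : HomLe (𝟙 _) (l ≫ h)) (l₂ : HomLe (h ≫ l) (𝟙 _)) {m n : ℕ}
    (d : Diag S (rights m) (rights n)) (hd : d.IsAutomaton) :
    F.map (mk d) ≫ power F G h n = power F G h m ≫ G.map (mk d) := by
  obtain ⟨e, rfl, he⟩ := exists_lax_extend H isMonoidalPreorder_homLe r r₁ r₂
  obtain ⟨e', he'', he'⟩ := exists_lax_extend H isMonoidalPreorder_homLe.swap l l₁ l₂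
  have i := he d hd
  have j := he' d hd
  rw [extend_rights, extend_rights] at i j
  rw [he''] at j
  exact i.antisymm j

end

end Obj

/-! ### The constant and doubling functors, and (co)monoid identities -/

section functors

variable (C : Type*) [Category* C] [MonoidalCategory C]

/-- The functor that sends every object to the monoidal unit. -/
@[simps!]
def constUnit : C ⥤ C := (Functor.const C).obj (𝟙_ C)

instance : (constUnit C).Monoidal :=
  Functor.CoreMonoidal.toMonoidal
    { εIso := Iso.refl (𝟙_ C)
      μIso := fun _ _ => λ_ (𝟙_ C)
      μIso_hom_natural_left := fun _ _ => by
        change 𝟙 (𝟙_ C) ▷ 𝟙_ C ≫ (λ_ (𝟙_ C)).hom = (λ_ (𝟙_ C)).hom ≫ 𝟙 (𝟙_ C)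
        simp
      μIso_hom_natural_right := fun _ _ => by
        change 𝟙_ C ◁ 𝟙 (𝟙_ C) ≫ (λ_ (𝟙_ C)).hom = (λ_ (𝟙_ C)).hom ≫ 𝟙 (𝟙_ C)
        simp
      associativity := fun _ _ _ => by
        change (λ_ (𝟙_ C)).hom ▷ 𝟙_ C ≫ (λ_ (𝟙_ C)).hom ≫ 𝟙 (𝟙_ C) =
          (α_ _ _ _).hom ≫ 𝟙_ C ◁ (λ_ (𝟙_ C)).hom ≫ (λ_ (𝟙_ C)).hom
        monoidal
      left_unitality := fun _ => by
        change (λ_ (𝟙_ C)).hom = 𝟙 (𝟙_ C) ▷ 𝟙_ C ≫ (λ_ (𝟙_ C)).hom ≫ 𝟙 (𝟙_ C)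
        simp
      right_unitality := fun _ => by
        change (ρ_ (𝟙_ C)).hom = 𝟙_ C ◁ 𝟙 (𝟙_ C) ≫ (λ_ (𝟙_ C)).hom ≫ 𝟙 (𝟙_ C)
        simp [unitors_equal] }

/-- The functor that sends an object `A` to `A ⊗ A`. -/
@[simps!]
def double : C ⥤ C := Functor.diag C ⋙ tensor C

variable [SymmetricCategory C]

instance : (constUnit C).Braided where
  braided X Y := by
    change (λ_ (𝟙_ C)).hom ≫ 𝟙 (𝟙_ C) = (β_ (𝟙_ C) (𝟙_ C)).hom ≫ (λ_ (𝟙_ C)).hom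
    rw [braiding_leftUnitor, unitors_equal, Category.comp_id]

instance : (double C).Monoidal :=
  Functor.CoreMonoidal.toMonoidal
    { εIso := (λ_ (𝟙_ C)).symm
      μIso := fun X Y =>
        { hom := tensorμ X X Y Y
          inv := tensorδ X X Y Y
          hom_inv_id := tensorμ_tensorδ X X Y Y
          inv_hom_id := tensorδ_tensorμ X X Y Y }
      μIso_hom_natural_left := fun f Z => tensorμ_natural_left f f Z Z
      μIso_hom_natural_right := fun Z f => tensorμ_natural_right Z Z f f
      associativity := fun X Y Z => tensor_associativity X X Y Y Z Z
      left_unitality := fun X => tensor_left_unitality X X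
      right_unitality := fun X => tensor_right_unitality X X }

theorem double_μ (X Y : C) : μ (double C) X Y = tensorμ X X Y Y := rfl

instance : (double C).Braided where
  braided X Y := by
    rw [double_μ, double_μ]
    change tensorμ X X Y Y ≫ ((β_ X Y).hom ⊗ₘ (β_ X Y).hom) =
      (β_ (X ⊗ X) (Y ⊗ Y)).hom ≫ tensorμ Y Y X X
    -- Expanding the crossing of the two blocks exposes a double crossing in the middle, which
    -- symmetry removes.
    have h : (β_ (X ⊗ X) (Y ⊗ Y)).hom ≫ tensorμ Y Y X X =
        𝟙 _ ⊗≫ X ◁ (β_ X Y).hom ▷ Y ⊗≫ (β_ X Y).hom ▷ (X ⊗ Y) ⊗≫ (Y ⊗ X) ◁ (β_ X Y).hom ⊗≫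
          Y ◁ ((β_ X Y).hom ≫ (β_ Y X).hom) ▷ X ⊗≫ 𝟙 _ := by
      simp only [tensorμ, BraidedCategory.braiding_tensor_left_hom,
        BraidedCategory.braiding_tensor_right_hom]
      monoidal
    rw [h, SymmetricCategory.symmetry, tensorμ, MonoidalCategory.tensorHom_def]
    monoidal

open ComonObj in
-- A comonoid is a monoid in the opposite category, where this is the interchange law of a
-- commutative monoid. It expresses naturality of copying at the copy node itself.
theorem comul_comul_tensorμ {C : Type*} [Category* C] [MonoidalCategory C] [BraidedCategory C]
    (M : C) [ComonObj M] [IsCommComonObj M] :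
    Δ[M] ≫ (Δ[M] ⊗ₘ Δ[M]) ≫ tensorμ M M M M = Δ[M] ≫ (Δ[M] ⊗ₘ Δ[M]) := by
  let _ : MonObj (Opposite.op M) := (Comon.ComonToMonOpOpObj ⟨M⟩).mon
  have _ : IsCommMonObj (Opposite.op M) := ⟨congrArg Quiver.Hom.op (IsCommComonObj.comul_comm M)⟩
  have h := congrArg Quiver.Hom.unop (MonObj.mul_mul_mul_comm (Opposite.op M))
  simp only [unop_comp, BraidedCategory.unop_tensorμ, Category.assoc] at h
  exact h

open ComonObj in
theorem comul_counit_counit {C : Type*} [Category* C] [MonoidalCategory C]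
    (M : C) [ComonObj M] :
    Δ[M] ≫ (ε[M] ⊗ₘ ε[M]) = ε[M] ≫ (λ_ (𝟙_ C)).inv := by
  rw [MonoidalCategory.tensorHom_def, counit_comul_assoc, leftUnitor_inv_naturality]

theorem one_one_mul {C : Type*} [Category* C] [MonoidalCategory C]
    (M : C) [MonObj M] :
    (MonObj.one (X := M) ⊗ₘ MonObj.one (X := M)) ≫ MonObj.mul =
      (λ_ (𝟙_ C)).hom ≫ MonObj.one := by
  rw [MonoidalCategory.tensorHom_def', Category.assoc, MonObj.one_mul, leftUnitor_naturality]

end functors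

/-! ### Black nodes on several wires and naturality at the generators -/

namespace Obj

variable {S : Type u}

theorem tensorμ_cons (A : List Wire) : tensorμ (of S [rt]) (of S [rt]) (of S A) (of S A) =
    mk (Diag.cast rfl (congrArg (List.cons rt) (List.append_assoc A [rt] A))
      (Diag.id [rt] ⊞ Diag.swap [rt] A ⊞ Diag.id A)) := by
  rw [mk_cast]
  have h : of S [rt] ◁ (α_ (of S A) (of S [rt]) (of S A)).hom =
      eqToHom (congrArg (of S) (congrArg (List.cons rt) (List.append_assoc A [rt] A))) :=
    tensorMap_eqToHom (A := of S [rt]) rfl (append_assoc (of S A) (of S [rt]) (of S A))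
  rw [tensorμ, h]
  change 𝟙 _ ≫ of S [rt] ◁ 𝟙 _ ≫ of S [rt] ◁ (β_ (of S [rt]) (of S A)).hom ▷ of S A ≫
    eqToHom _ ≫ 𝟙 _ = 𝟙 _ ≫ (of S [rt] ◁ (β_ (of S [rt]) (of S A)).hom ▷ of S A) ≫ eqToHom _
  rw [MonoidalCategory.whiskerLeft_id, Category.comp_id]
  erw [Category.id_comp]

theorem tensorδ_cons (A : List Wire) : tensorδ (of S [rt]) (of S [rt]) (of S A) (of S A) =
    mk (Diag.cast (congrArg (List.cons rt) (List.append_assoc A [rt] A)) rfl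
      (Diag.id [rt] ⊞ Diag.swap A [rt] ⊞ Diag.id A)) := by
  rw [mk_cast]
  have h : of S [rt] ◁ (α_ (of S A) (of S [rt]) (of S A)).inv =
      eqToHom (congrArg (of S) (congrArg (List.cons rt) (List.append_assoc A [rt] A).symm)) :=
    tensorMap_eqToHom (A := of S [rt]) rfl (append_assoc (of S A) (of S [rt]) (of S A)).symm
  rw [tensorδ, h]
  change 𝟙 _ ≫ eqToHom _ ≫ of S [rt] ◁ (β_ (of S [rt]) (of S A)).inv ▷ of S A ≫
    of S [rt] ◁ 𝟙 _ ≫ 𝟙 _ = eqToHom _ ≫ (of S [rt] ◁ (β_ (of S [rt]) (of S A)).inv ▷ of S A) ≫ 𝟙 _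
  rw [MonoidalCategory.whiskerLeft_id]
  erw [Category.id_comp, Category.id_comp]

/-- The morphism of the crossing of the two middle wires among four. -/
def midHom (S : Type u) : (of S [rt] ⊗ of S [rt]) ⊗ of S [rt] ⊗ of S [rt] ⟶
    (of S [rt] ⊗ of S [rt]) ⊗ of S [rt] ⊗ of S [rt] := mk Diag.mid

theorem tensorμ_right :
    tensorμ (of S [rt]) (of S [rt]) (of S [rt]) (of S [rt]) = midHom S := tensorμ_cons [rt]

theorem tensorδ_right :
    tensorδ (of S [rt]) (of S [rt]) (of S [rt]) (of S [rt]) = midHom S := tensorδ_cons [rt]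

/-- The recursive step of `copyN` is the monoidal comparison `tensorμ` of the doubling functor; the
next three lemmas are analogous. -/
theorem power_copyN (n : ℕ) :
    power (𝟭 (Obj S)) (double (Obj S)) (copyHom S) n = mk (Diag.copyN n) := by
  induction n with
  | zero => exact Category.id_comp _
  | succ n ih =>
    refine (congrArg (conj (𝟭 (Obj S)) (double (Obj S)) (A := of S [rt]) (B := of S (rights n))
      (copyHom S)) ih).trans ?_
    change 𝟙 _ ≫ (copyHom S ⊗ₘ mk (Diag.copyN n)) ≫
      tensorμ (of S [rt]) _ (of S (rights n)) (of S (rights n)) = _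
    rw [tensorμ_cons]
    exact Category.id_comp _

theorem power_deleteN (n : ℕ) :
    power (𝟭 (Obj S)) (constUnit (Obj S)) (deleteHom S) n = mk (Diag.deleteN n) := by
  induction n with
  | zero => exact Category.id_comp _
  | succ n ih =>
    refine (congrArg (conj (𝟭 (Obj S)) (constUnit (Obj S)) (A := of S [rt]) (B := of S (rights n))
      (deleteHom S)) ih).trans ?_
    change 𝟙 _ ≫ (deleteHom S ⊗ₘ mk (Diag.deleteN n)) ≫ 𝟙 _ = _
    exact (Category.id_comp _).trans (Category.comp_id _)

theorem power_mergeN (n : ℕ) :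
    power (double (Obj S)) (𝟭 (Obj S)) (mergeHom S) n = mk (Diag.mergeN n) := by
  induction n with
  | zero => exact Category.id_comp _
  | succ n ih =>
    refine (congrArg (conj (double (Obj S)) (𝟭 (Obj S)) (A := of S [rt]) (B := of S (rights n))
      (mergeHom S)) ih).trans ?_
    change tensorδ (of S [rt]) _ (of S (rights n)) (of S (rights n)) ≫
      (mergeHom S ⊗ₘ mk (Diag.mergeN n)) ≫ 𝟙 _ = _
    rw [tensorδ_cons]
    exact congrArg (_ ≫ ·) (Category.comp_id _)

theorem power_generateN (n : ℕ) :
    power (constUnit (Obj S)) (𝟭 (Obj S)) (generateHom S) n = mk (Diag.generateN n) := by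
  induction n with
  | zero => exact Category.id_comp _
  | succ n ih =>
    refine (congrArg (conj (constUnit (Obj S)) (𝟭 (Obj S)) (A := of S [rt]) (B := of S (rights n))
      (generateHom S)) ih).trans ?_
    change 𝟙 _ ≫ (generateHom S ⊗ₘ mk (Diag.generateN n)) ≫ 𝟙 _ = _
    exact (Category.id_comp _).trans (Category.comp_id _)

instance : ComonObj (of S [rt]) where
  comul := copyHom S
  counit := deleteHom S
  comul_counit := mk_ax Diag.AxEq.B2
  counit_comul := by
    -- The axioms contain only one counit law; cocommutativity supplies the other.
    have h : copyHom S ≫ (β_ _ _).hom = copyHom S := mk_ax Diag.AxEq.B3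
    have h' : copyHom S ≫ of S [rt] ◁ deleteHom S = (ρ_ _).inv := mk_ax Diag.AxEq.B2
    rw [← h, Category.assoc, ← BraidedCategory.braiding_naturality_right, reassoc_of% h',
      rightUnitor_inv_braiding]
  comul_assoc := by
    have h := mk_ax (Diag.AxEq.B1 (S := S))
    refine Eq.trans h.symm ?_
    exact congrArg (copyHom S ≫ ·) (Category.comp_id (copyHom S ▷ of S [rt])).symm

instance : IsCommComonObj (of S [rt]) where
  comul_comm := mk_ax Diag.AxEq.B3

instance : MonObj (of S [rt]) where
  mul := mergeHom S
  one := generateHom S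
  mul_one := mk_ax Diag.AxEq.B5
  one_mul := by
    have h : (β_ _ _).hom ≫ mergeHom S = mergeHom S := mk_ax Diag.AxEq.B6
    have h' : of S [rt] ◁ generateHom S ≫ mergeHom S = (ρ_ _).hom := mk_ax Diag.AxEq.B5
    rw [← h, BraidedCategory.braiding_naturality_left_assoc, h', braiding_rightUnitor]
  mul_assoc := by
    have h := mk_ax (Diag.AxEq.B4 (S := S))
    refine Eq.trans h ?_
    exact (Category.id_comp _).symm

instance : IsCommMonObj (of S [rt]) where
  mul_comm := mk_ax Diag.AxEq.B6

theorem copyHom_copyHom : copyHom S ≫ (copyHom S ⊗ₘ copyHom S) ≫ midHom S =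
    copyHom S ≫ (copyHom S ⊗ₘ copyHom S) := by
  have h := comul_comul_tensorμ (of S [rt])
  rw [tensorμ_right] at h
  exact h

theorem copyHom_deleteHom : copyHom S ≫ (deleteHom S ⊗ₘ deleteHom S) =
    deleteHom S ≫ (λ_ _).inv := comul_counit_counit (of S [rt])

theorem mergeHom_mergeHom : midHom S ≫ (mergeHom S ⊗ₘ mergeHom S) ≫ mergeHom S =
    (mergeHom S ⊗ₘ mergeHom S) ≫ mergeHom S := by
  have h := MonObj.mul_mul_mul_comm (of S [rt])
  rw [tensorμ_right] at h
  exact h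

theorem generateHom_mergeHom : (generateHom S ⊗ₘ generateHom S) ≫ mergeHom S =
    (λ_ _).hom ≫ generateHom S := one_one_mul (of S [rt])

theorem mergeHom_copyHom : mergeHom S ≫ copyHom S =
    (copyHom S ⊗ₘ copyHom S) ≫ midHom S ≫ (mergeHom S ⊗ₘ mergeHom S) :=
  (mk_ax Diag.AxEq.B7).trans
    (Category.assoc (copyHom S ⊗ₘ copyHom S) (midHom S) (mergeHom S ⊗ₘ mergeHom S))

theorem generateHom_copyHom : generateHom S ≫ copyHom S =
    (λ_ _).inv ≫ (generateHom S ⊗ₘ generateHom S) :=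
  (mk_ax Diag.AxEq.B8).trans (Category.id_comp _).symm

theorem mergeHom_deleteHom : mergeHom S ≫ deleteHom S =
    (deleteHom S ⊗ₘ deleteHom S) ≫ (λ_ _).hom :=
  (mk_ax Diag.AxEq.B9).trans (Category.comp_id _).symm

theorem generateHom_deleteHom : generateHom S ≫ deleteHom S = 𝟙 _ := mk_ax Diag.AxEq.B11

/-- At copy and delete this uses that the comonoid is cocommutative and counital; at merge and
generate it is the bimonoid law. -/
theorem isNaturalOnGenerators_copy :
    IsNaturalOnGenerators (𝟭 (Obj S)) (double (Obj S)) (copyHom S) where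
  copy := by
    change copyHom S ≫ 𝟙 _ ≫ (copyHom S ⊗ₘ copyHom S) ≫ tensorμ (of S [rt]) _ _ _ =
      copyHom S ≫ (copyHom S ⊗ₘ copyHom S)
    rw [tensorμ_right, Category.id_comp, copyHom_copyHom]
  delete := by
    change deleteHom S ≫ 𝟙 _ ≫ (λ_ _).inv = copyHom S ≫ (deleteHom S ⊗ₘ deleteHom S)
    rw [Category.id_comp, copyHom_deleteHom]
  merge := by
    change mergeHom S ≫ copyHom S = (𝟙 _ ≫ (copyHom S ⊗ₘ copyHom S) ≫ tensorμ (of S [rt]) _ _ _) ≫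
      (mergeHom S ⊗ₘ mergeHom S)
    rw [tensorμ_right, Category.id_comp, mergeHom_copyHom, Category.assoc]
  generate := by
    change generateHom S ≫ copyHom S = (𝟙 _ ≫ (λ_ _).inv) ≫ (generateHom S ⊗ₘ generateHom S)
    rw [Category.id_comp, generateHom_copyHom]
  letter a := mk_ax (.E6 a)

theorem isNaturalOnGenerators_delete :
    IsNaturalOnGenerators (𝟭 (Obj S)) (constUnit (Obj S)) (deleteHom S) where
  copy := by
    change copyHom S ≫ 𝟙 _ ≫ (deleteHom S ⊗ₘ deleteHom S) ≫ (λ_ _).hom = deleteHom S ≫ 𝟙 _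
    rw [Category.id_comp, reassoc_of% copyHom_deleteHom, Iso.inv_hom_id]
  delete := by
    change deleteHom S ≫ 𝟙 _ ≫ 𝟙 _ = deleteHom S ≫ 𝟙 _
    simp
  merge := by
    change mergeHom S ≫ deleteHom S = (𝟙 _ ≫ (deleteHom S ⊗ₘ deleteHom S) ≫ (λ_ _).hom) ≫ 𝟙 _
    rw [mergeHom_deleteHom, Category.id_comp, Category.comp_id]
  generate := by
    change generateHom S ≫ deleteHom S = (𝟙 _ ≫ 𝟙 _) ≫ 𝟙 _
    rw [generateHom_deleteHom, Category.id_comp, Category.id_comp]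
  letter a := (mk_ax (.E7 a)).trans (Category.comp_id _).symm

theorem isNaturalOnGenerators_merge :
    IsNaturalOnGenerators (double (Obj S)) (𝟭 (Obj S)) (mergeHom S) where
  copy := by
    change (copyHom S ⊗ₘ copyHom S) ≫ tensorδ (of S [rt]) _ _ _ ≫ (mergeHom S ⊗ₘ mergeHom S) ≫ 𝟙 _ =
      mergeHom S ≫ copyHom S
    rw [tensorδ_right, Category.comp_id, mergeHom_copyHom]
  delete := by
    change (deleteHom S ⊗ₘ deleteHom S) ≫ (λ_ _).hom ≫ 𝟙 _ = mergeHom S ≫ deleteHom S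
    rw [Category.comp_id, mergeHom_deleteHom]
  merge := by
    change (mergeHom S ⊗ₘ mergeHom S) ≫ mergeHom S =
      (tensorδ (of S [rt]) _ _ _ ≫ (mergeHom S ⊗ₘ mergeHom S) ≫ 𝟙 _) ≫ mergeHom S
    rw [tensorδ_right, Category.comp_id, Category.assoc, mergeHom_mergeHom]
  generate := by
    change (generateHom S ⊗ₘ generateHom S) ≫ mergeHom S =
      ((λ_ _).hom ≫ 𝟙 _) ≫ generateHom S
    rw [Category.comp_id, generateHom_mergeHom]
  letter a := (mk_ax (.E10 a)).symm

theorem isNaturalOnGenerators_generate :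
    IsNaturalOnGenerators (constUnit (Obj S)) (𝟭 (Obj S)) (generateHom S) where
  copy := by
    change 𝟙 _ ≫ (λ_ _).inv ≫ (generateHom S ⊗ₘ generateHom S) ≫ 𝟙 _ = generateHom S ≫ copyHom S
    rw [generateHom_copyHom, Category.id_comp, Category.comp_id]
  delete := by
    change 𝟙 _ ≫ 𝟙 _ ≫ 𝟙 _ = generateHom S ≫ deleteHom S
    rw [generateHom_deleteHom, Category.id_comp, Category.id_comp]
  merge := by
    change 𝟙 _ ≫ generateHom S =
      ((λ_ _).inv ≫ (generateHom S ⊗ₘ generateHom S) ≫ 𝟙 _) ≫ mergeHom S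
    rw [Category.id_comp, Category.comp_id, Category.assoc, generateHom_mergeHom,
      Iso.inv_hom_id_assoc]
  generate := by
    change 𝟙 _ ≫ generateHom S = (𝟙 _ ≫ 𝟙 _) ≫ generateHom S
    simp
  letter a := (Category.id_comp _).trans (mk_ax (.E11 a)).symm

/-! ### The four distributivity laws -/

variable {m n : ℕ} (d : Diag S (rights m) (rights n)) (hd : d.IsAutomaton)
include hd

/-- Copy sits between its left adjoint `wmult` and its right adjoint `merge`. -/
theorem comp_copyN : mk d ≫ mk (Diag.copyN n) = mk (Diag.copyN m) ≫ mk (d ⊞ d) := by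
  have h := power_natural isNaturalOnGenerators_copy (mergeHom S) (mk Diag.wmult)
    (Diag.Le.le .F1) (Diag.Le.le .F3) (Diag.Le.le .F5) (Diag.Le.le .F7) d hd
  rwa [power_copyN, power_copyN] at h

theorem comp_deleteN : mk d ≫ mk (Diag.deleteN n) = mk (Diag.deleteN m) := by
  have h := power_natural isNaturalOnGenerators_delete (generateHom S) (mk Diag.wunit)
    (Diag.Le.le .F4) (Diag.Le.le .F2) (Diag.Le.le .F8) (Diag.Le.le .F6) d hd
  rw [power_deleteN, power_deleteN] at h
  exact h.trans (Category.comp_id _)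

/-- Merge sits between its left adjoint `copy` and its right adjoint `wcomult`. -/
theorem mergeN_comp : mk (Diag.mergeN m) ≫ mk d = mk (d ⊞ d) ≫ mk (Diag.mergeN n) := by
  have h := power_natural isNaturalOnGenerators_merge (mk Diag.wcomult) (copyHom S)
    (Diag.Le.le .F11) (Diag.Le.le .F9) (Diag.Le.le .F3) (Diag.Le.le .F1) d hd
  rw [power_mergeN, power_mergeN] at h
  exact h.symm

theorem generateN_comp : mk (Diag.generateN m) ≫ mk d = mk (Diag.generateN n) := by
  have h := power_natural isNaturalOnGenerators_generate (mk Diag.wcounit) (deleteHom S)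
    (Diag.Le.le .F10) (Diag.Le.le .F12) (Diag.Le.le .F2) (Diag.Le.le .F4) d hd
  rw [power_generateN, power_generateN] at h
  exact h.symm.trans (Category.id_comp _)

end Obj

/-! ### (Co)monoids on monoidal products -/

section tensor

variable {C : Type*} [Category* C] [MonoidalCategory C] [SymmetricCategory C]

theorem tensorδ_eq_tensorμ (X Y : C) : tensorδ X X Y Y = tensorμ X Y X Y := by
  simp [tensorμ, tensorδ, SymmetricCategory.braiding_swap_eq_inv_braiding]

theorem tensorμ_unit_unit (X Y : C) :
    tensorμ X (𝟙_ C) (𝟙_ C) Y ≫ ((ρ_ X).hom ⊗ₘ (λ_ Y).hom) = ((ρ_ X).hom ⊗ₘ (λ_ Y).hom) := by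
  have h : (β_ (𝟙_ C) (𝟙_ C)).hom = 𝟙 _ := by
    rw [braiding_tensorUnit_left, unitors_equal, Iso.hom_inv_id]
  simp only [tensorμ, h]
  monoidal

open ComonObj in
-- Naturality of `tensorμ` pulls the counits back to their own comultiplications; what remains is a
-- crossing of two units, which is trivial.
theorem comul_fst_snd (X Y : C) [ComonObj X] [ComonObj Y] :
    (Δ[X] ⊗ₘ Δ[Y]) ≫ tensorμ X X Y Y ≫
      ((X ◁ ComonObj.counit ≫ (ρ_ X).hom) ⊗ₘ (ComonObj.counit ▷ Y ≫ (λ_ Y).hom)) = 𝟙 _ := by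
  have h := tensorμ_natural (𝟙 X) (ComonObj.counit (X := X)) (ComonObj.counit (X := Y)) (𝟙 Y)
  rw [← tensorHom_comp_tensorHom, ← id_tensorHom, ← tensorHom_id, ← reassoc_of% h,
    tensorμ_unit_unit, id_tensorHom, tensorHom_id, tensorHom_comp_tensorHom,
    tensorHom_comp_tensorHom]
  simp

theorem inl_inr_mul (X Y : C) [MonObj X] [MonObj Y] :
    (((ρ_ X).inv ≫ X ◁ MonObj.one) ⊗ₘ ((λ_ Y).inv ≫ MonObj.one ▷ Y)) ≫ tensorδ X X Y Y ≫
      (MonObj.mul ⊗ₘ MonObj.mul) = 𝟙 _ := by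
  have h := tensorμ_natural (𝟙 X) (MonObj.one (X := Y)) (MonObj.one (X := X)) (𝟙 Y)
  have h' : ((ρ_ X).inv ⊗ₘ (λ_ Y).inv) ≫ tensorμ X (𝟙_ C) (𝟙_ C) Y = (ρ_ X).inv ⊗ₘ (λ_ Y).inv := by
    have := tensorμ_unit_unit X Y
    rw [← cancel_mono ((ρ_ X).hom ⊗ₘ (λ_ Y).hom), Category.assoc, this]
  rw [tensorδ_eq_tensorμ, ← tensorHom_comp_tensorHom, ← id_tensorHom, ← tensorHom_id,
    Category.assoc, reassoc_of% h, reassoc_of% h', id_tensorHom, tensorHom_id,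
    tensorHom_comp_tensorHom, tensorHom_comp_tensorHom]
  simp

end tensor

namespace Obj

variable {S : Type u}

/-- The deletion of `n` wires. -/
def del (S : Type u) (n : ℕ) : of S (rights n) ⟶ 𝟙_ (Obj S) := mk (Diag.deleteN n)

/-- The co-deletion of `n` wires. -/
def gen (S : Type u) (n : ℕ) : 𝟙_ (Obj S) ⟶ of S (rights n) := mk (Diag.generateN n)

/-- The copying of `n` wires. -/
def dup (S : Type u) (n : ℕ) : of S (rights n) ⟶ of S (rights n) ⊗ of S (rights n) :=
  mk (Diag.copyN n)

/-- The merging of `n` wires. -/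
def fuse (S : Type u) (n : ℕ) : of S (rights n) ⊗ of S (rights n) ⟶ of S (rights n) :=
  mk (Diag.mergeN n)

theorem dup_succ (n : ℕ) : dup S (n + 1) = (copyHom S ⊗ₘ dup S n) ≫
    tensorμ (of S [rt]) (of S [rt]) (of S (rights n)) (of S (rights n)) := by
  rw [tensorμ_cons]
  rfl

theorem fuse_succ (n : ℕ) : fuse S (n + 1) =
    tensorδ (of S [rt]) (of S [rt]) (of S (rights n)) (of S (rights n)) ≫
      (mergeHom S ⊗ₘ fuse S n) := by
  rw [tensorδ_cons]
  rfl

/-- The comonoid structure on `n` wires. -/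
@[reducible]
def comonObjRights (S : Type u) : (n : ℕ) →
    {M : ComonObj (of S (rights n)) // M.comul = dup S n ∧ M.counit = del S n}
  | 0 => ⟨ComonObj.instTensorUnit (Obj S), rfl, rfl⟩
  | n + 1 =>
    let _ : ComonObj (of S (rights n)) := (comonObjRights S n).1
    ⟨inferInstanceAs (ComonObj (of S [rt] ⊗ of S (rights n))), by
      refine (Comon.tensorObj_comul (of S [rt]) (of S (rights n))).trans ?_
      rw [(comonObjRights S n).2.1, dup_succ]
      rfl, by
      refine (Comon.tensorObj_counit (of S [rt]) (of S (rights n))).trans ?_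
      rw [(comonObjRights S n).2.2]
      exact Category.comp_id _⟩

/-- The monoid structure on `n` wires. -/
@[reducible]
def monObjRights (S : Type u) : (n : ℕ) →
    {M : MonObj (of S (rights n)) // M.mul = fuse S n ∧ M.one = gen S n}
  | 0 => ⟨inferInstanceAs (MonObj (𝟙_ (Obj S))), rfl, rfl⟩
  | n + 1 =>
    let _ : MonObj (of S (rights n)) := (monObjRights S n).1
    ⟨inferInstanceAs (MonObj (of S [rt] ⊗ of S (rights n))), by
      refine (MonObj.tensorObj.mul_def (M := of S [rt]) (N := of S (rights n))).trans ?_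
      rw [(monObjRights S n).2.1, fuse_succ, tensorδ_eq_tensorμ]
      rfl, by
      refine (MonObj.tensorObj.one_def (M := of S [rt]) (N := of S (rights n))).trans ?_
      rw [(monObjRights S n).2.2]
      exact Category.id_comp _⟩

/-- A counit law of the iterated tensor comonoid `comonObjRights`. -/
theorem dup_del (n : ℕ) : dup S n ≫ of S (rights n) ◁ del S n = (ρ_ _).inv := by
  obtain ⟨M, h, h'⟩ := comonObjRights S n
  rw [← h, ← h']
  exact M.comul_counit

theorem del_dup (n : ℕ) : dup S n ≫ del S n ▷ of S (rights n) = (λ_ _).inv := by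
  obtain ⟨M, h, h'⟩ := comonObjRights S n
  rw [← h, ← h']
  exact M.counit_comul

theorem fuse_gen (n : ℕ) : of S (rights n) ◁ gen S n ≫ fuse S n = (ρ_ _).hom := by
  obtain ⟨M, h, h'⟩ := monObjRights S n
  rw [← h, ← h']
  exact M.mul_one

theorem gen_fuse (n : ℕ) : gen S n ▷ of S (rights n) ≫ fuse S n = (λ_ _).hom := by
  obtain ⟨M, h, h'⟩ := monObjRights S n
  rw [← h, ← h']
  exact M.one_mul

/-- Naturality of deletion, applied to the automaton-diagram `generateN n`. -/
theorem gen_del (n : ℕ) : gen S n ≫ del S n = 𝟙 _ :=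
  comp_deleteN (m := 0) (Diag.generateN n) (Diag.isAutomaton_generateN n)

/-- The monoidal product of `m` wires and `n` wires. -/
def addIso (S : Type u) (m n : ℕ) :
    of S (rights m) ⊗ of S (rights n) ≅ of S (rights (m + n)) :=
  eqToIso (congrArg (of S) (LR.rights_add m n))

theorem conj_power_add (F G : Obj S ⥤ Obj S) [F.Braided] [G.Braided]
    (h : F.obj (of S [rt]) ⟶ G.obj (of S [rt])) (r : G.obj (of S [rt]) ⟶ F.obj (of S [rt]))
    (m n : ℕ) : conj F G (power F G h m) (power F G h n) ≫ G.map (addIso S m n).hom =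
      F.map (addIso S m n).hom ≫ power F G h (m + n) := by
  -- Any left-pointing component would do: it only makes `extend` available, and with it
  -- `extend_append`.
  obtain ⟨k, -⟩ := exists_mate F G (of S [lt]) (of S [rt]) r
  let e : ∀ w : Wire, F.obj (of S [w]) ⟶ G.obj (of S [w]) := fun w => Wire.rec h k w
  have key : ∀ {A B : List Wire} (p : A = B),
      extend F G e A ≫ G.map (eqToHom (congrArg (of S) p)) =
        F.map (eqToHom (congrArg (of S) p)) ≫ extend F G e B := by
    rintro A _ rfl
    simp
  have := key (LR.rights_add m n)
  rw [extend_append, extend_rights, extend_rights, extend_rights] at this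
  exact this

theorem dup_add (m n : ℕ) : (dup S m ⊗ₘ dup S n) ≫ tensorμ _ _ _ _ ≫
    ((addIso S m n).hom ⊗ₘ (addIso S m n).hom) = (addIso S m n).hom ≫ dup S (m + n) := by
  have h := conj_power_add (𝟭 (Obj S)) (double (Obj S)) (copyHom S) (mergeHom S) m n
  rw [power_copyN, power_copyN, power_copyN] at h
  refine Eq.trans ?_ h
  change _ = (𝟙 _ ≫ (dup S m ⊗ₘ dup S n) ≫ tensorμ _ _ _ _) ≫
    ((addIso S m n).hom ⊗ₘ (addIso S m n).hom)
  rw [Category.id_comp, Category.assoc]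

theorem fuse_add (m n : ℕ) : tensorδ _ _ _ _ ≫ (fuse S m ⊗ₘ fuse S n) ≫ (addIso S m n).hom =
    ((addIso S m n).hom ⊗ₘ (addIso S m n).hom) ≫ fuse S (m + n) := by
  have h := conj_power_add (double (Obj S)) (𝟭 (Obj S)) (mergeHom S) (copyHom S) m n
  rw [power_mergeN, power_mergeN, power_mergeN] at h
  refine Eq.trans ?_ h
  change _ = (tensorδ _ _ _ _ ≫ (fuse S m ⊗ₘ fuse S n) ≫ 𝟙 _) ≫ (addIso S m n).hom
  rw [Category.comp_id, Category.assoc]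

theorem dup_fst_snd (m n : ℕ) : dup S (m + n) ≫
    (((addIso S m n).inv ≫ of S (rights m) ◁ del S n ≫ (ρ_ _).hom) ⊗ₘ
      ((addIso S m n).inv ≫ del S m ▷ of S (rights n) ≫ (λ_ _).hom)) = (addIso S m n).inv := by
  rw [← cancel_epi (addIso S m n).hom, ← reassoc_of% dup_add, tensorHom_comp_tensorHom,
    Iso.hom_inv_id_assoc, Iso.hom_inv_id_assoc, Iso.hom_inv_id]
  obtain ⟨M, h, h'⟩ := comonObjRights S m
  obtain ⟨N, k, k'⟩ := comonObjRights S n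
  rw [← h, ← h', ← k, ← k']
  exact comul_fst_snd _ _

theorem inl_inr_fuse (m n : ℕ) :
    (((ρ_ _).inv ≫ of S (rights m) ◁ gen S n ≫ (addIso S m n).hom) ⊗ₘ
      ((λ_ _).inv ≫ gen S m ▷ of S (rights n) ≫ (addIso S m n).hom)) ≫ fuse S (m + n) =
        (addIso S m n).hom := by
  rw [← Category.assoc (ρ_ _).inv, ← Category.assoc (λ_ _).inv, ← tensorHom_comp_tensorHom,
    Category.assoc, ← fuse_add]
  obtain ⟨M, h, h'⟩ := monObjRights S m
  obtain ⟨N, k, k'⟩ := monObjRights S n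
  rw [← h, ← h', ← k, ← k']
  have := inl_inr_mul (of S (rights m)) (of S (rights n))
  rw [reassoc_of% this]

end Obj

/-! ### The biproduct of automaton-diagrams -/

namespace LR

open Obj

variable {S : Type u}

/-- The morphism of diagrams underlying a morphism of automaton-diagrams. -/
def toObj {X Y : LR S} (f : X ⟶ Y) : of S (rights X.n) ⟶ of S (rights Y.n) :=
  Quotient.map (sa := LR.homSetoid S X.n Y.n) (sb := Obj.homSetoid S _ _) Subtype.val
    (fun _ _ h => h) f

theorem exists_hom {X Y : LR S} (f : X ⟶ Y) :
    ∃ (d : Diag S (rights X.n) (rights Y.n)) (hd : d.IsAutomaton), hom d hd = f := by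
  obtain ⟨⟨d, hd⟩, rfl⟩ := Quotient.exists_rep f
  exact ⟨d, hd, rfl⟩

/-- Both hom-sets are quotients by the same relation `Eqv`, so equations can be proved in the larger
monoidal category. -/
theorem toObj_injective {X Y : LR S} {f g : X ⟶ Y} (h : toObj f = toObj g) : f = g := by
  obtain ⟨d, hd, rfl⟩ := exists_hom f
  obtain ⟨e, he, rfl⟩ := exists_hom g
  exact Quotient.sound (mk_eq_iff.1 h)

theorem toObj_id (X : LR S) : toObj (𝟙 X) = 𝟙 _ := rfl

theorem toObj_comp {X Y Z : LR S} (f : X ⟶ Y) (g : Y ⟶ Z) :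
    toObj (f ≫ g) = toObj f ≫ toObj g := by
  obtain ⟨d, hd, rfl⟩ := exists_hom f
  obtain ⟨e, he, rfl⟩ := exists_hom g
  rfl

section naturality

variable {X Y : LR S} (f : X ⟶ Y)

theorem toObj_dup : toObj f ≫ dup S Y.n = dup S X.n ≫ (toObj f ⊗ₘ toObj f) := by
  obtain ⟨d, hd, rfl⟩ := exists_hom f
  exact comp_copyN d hd

theorem toObj_del : toObj f ≫ del S Y.n = del S X.n := by
  obtain ⟨d, hd, rfl⟩ := exists_hom f
  exact comp_deleteN d hd

theorem fuse_toObj : fuse S X.n ≫ toObj f = (toObj f ⊗ₘ toObj f) ≫ fuse S Y.n := by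
  obtain ⟨d, hd, rfl⟩ := exists_hom f
  exact mergeN_comp d hd

theorem gen_toObj : gen S X.n ≫ toObj f = gen S Y.n := by
  obtain ⟨d, hd, rfl⟩ := exists_hom f
  exact generateN_comp d hd

end naturality

theorem isAutomaton_copyN : ∀ n : ℕ, (Diag.copyN n : Diag S _ _).IsAutomaton
  | 0 => trivial
  | n + 1 => ⟨⟨trivial, isAutomaton_copyN n⟩, Diag.IsAutomaton.cast _ _ ⟨trivial, trivial, trivial⟩⟩

theorem isAutomaton_mergeN : ∀ n : ℕ, (Diag.mergeN n : Diag S _ _).IsAutomaton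
  | 0 => trivial
  | n + 1 => ⟨Diag.IsAutomaton.cast _ _ ⟨trivial, trivial, trivial⟩, ⟨trivial, isAutomaton_mergeN n⟩⟩

/-- The monoidal product of the underlying objects. -/
def sumIso (X Y : LR S) :
    of S (rights X.n) ⊗ of S (rights Y.n) ≅ of S (rights (sum X Y).n) := addIso S X.n Y.n

/-- The diagonal. -/
def diag (X : LR S) : X ⟶ sum X X :=
  hom ((Diag.copyN X.n).cast rfl (rights_add _ _)) (.cast _ _ (isAutomaton_copyN _))

/-- The codiagonal. -/
def codiag (X : LR S) : sum X X ⟶ X :=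
  hom ((Diag.mergeN X.n).cast (rights_add _ _) rfl) (.cast _ _ (isAutomaton_mergeN _))

theorem toObj_diag (X : LR S) : toObj (diag X) = dup S X.n ≫ (sumIso X X).hom :=
  (mk_cast rfl (rights_add X.n X.n) (Diag.copyN X.n)).trans (Category.id_comp _)

theorem toObj_codiag (X : LR S) : toObj (codiag X) = (sumIso X X).inv ≫ fuse S X.n :=
  (mk_cast (rights_add X.n X.n) rfl (Diag.mergeN X.n)).trans
    (congrArg (eqToHom _ ≫ ·) (Category.comp_id _))

theorem toObj_sumMap {X Y X' Y' : LR S} (f : X ⟶ Y) (g : X' ⟶ Y') : toObj (sumMap f g) =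
    (sumIso X X').inv ≫ (toObj f ⊗ₘ toObj g) ≫ (sumIso Y Y').hom := by
  obtain ⟨d, hd, rfl⟩ := exists_hom f
  obtain ⟨e, he, rfl⟩ := exists_hom g
  exact mk_cast _ _ _

variable (X Y : LR S)

theorem toObj_fst : toObj (fst X Y) =
    (sumIso X Y).inv ≫ of S (rights X.n) ◁ del S Y.n ≫ (ρ_ _).hom := mk_cast _ _ _

theorem toObj_snd : toObj (snd X Y) =
    (sumIso X Y).inv ≫ del S X.n ▷ of S (rights Y.n) ≫ (λ_ _).hom :=
  mk_cast (rights_add X.n Y.n) rfl (Diag.deleteN X.n ⊞ Diag.id (rights Y.n))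

theorem toObj_inl : toObj (inl X Y) =
    (ρ_ _).inv ≫ of S (rights X.n) ◁ gen S Y.n ≫ (sumIso X Y).hom := mk_cast _ _ _

theorem toObj_inr : toObj (inr X Y) =
    (λ_ _).inv ≫ gen S X.n ▷ of S (rights Y.n) ≫ (sumIso X Y).hom :=
  mk_cast rfl (rights_add X.n Y.n) (Diag.generateN X.n ⊞ Diag.id (rights Y.n))

/-- Zero is deletion followed by co-deletion; it absorbs composites by naturality of each. -/
instance hasZeroMorphisms : HasZeroMorphisms (LR S) where
  zero X Y := ⟨hom (Diag.deleteN X.n ⨾ Diag.generateN Y.n)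
    ⟨Diag.isAutomaton_deleteN _, Diag.isAutomaton_generateN _⟩⟩
  comp_zero f Z := toObj_injective <| by
    rw [toObj_comp]
    change toObj f ≫ del S _ ≫ gen S _ = del S _ ≫ gen S _
    rw [← Category.assoc, toObj_del]
  zero_comp X _ _ f := toObj_injective <| by
    rw [toObj_comp]
    change (del S _ ≫ gen S _) ≫ toObj f = del S _ ≫ gen S _
    rw [Category.assoc, gen_toObj]

theorem toObj_zero : toObj (0 : X ⟶ Y) = del S X.n ≫ gen S Y.n := rfl

theorem isZero_zero : IsZero (⟨0⟩ : LR S) := by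
  refine ⟨fun Y => ⟨⟨⟨0⟩, fun f => toObj_injective ?_⟩⟩,
    fun Y => ⟨⟨⟨0⟩, fun f => toObj_injective ?_⟩⟩⟩
  · change _ = del S 0 ≫ gen S Y.n
    -- On zero wires, deletion and co-deletion are identities, so naturality of co-deletion
    -- determines `f`.
    rw [← gen_toObj f]
    exact ((Category.id_comp _).trans (Category.id_comp _)).symm
  · change _ = del S Y.n ≫ gen S 0
    rw [← toObj_del f, Category.assoc]
    exact ((congrArg (toObj f ≫ ·) (Category.id_comp _)).trans (Category.comp_id _)).symm

theorem inl_fst : inl X Y ≫ fst X Y = 𝟙 X := toObj_injective <| by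
  rw [toObj_comp, toObj_inl, toObj_fst, toObj_id]
  simp only [Category.assoc, Iso.hom_inv_id_assoc, ← MonoidalCategory.whiskerLeft_comp_assoc,
    gen_del]
  simp

theorem inr_snd : inr X Y ≫ snd X Y = 𝟙 Y := toObj_injective <| by
  rw [toObj_comp, toObj_inr, toObj_snd, toObj_id]
  simp only [Category.assoc, Iso.hom_inv_id_assoc, ← comp_whiskerRight_assoc, gen_del]
  simp

theorem inl_snd : inl X Y ≫ snd X Y = 0 := toObj_injective <| by
  rw [toObj_comp, toObj_inl, toObj_snd, toObj_zero]
  simp [whisker_exchange_assoc, unitors_equal]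

theorem inr_fst : inr X Y ≫ fst X Y = 0 := toObj_injective <| by
  rw [toObj_comp, toObj_inr, toObj_fst, toObj_zero]
  simp [← whisker_exchange_assoc, ← unitors_equal]

section maps

variable {X Y}
variable {X' Y' : LR S} (f : X ⟶ Y) (g : X' ⟶ Y')

/-- The discarded factor `g` is absorbed by naturality of deletion; for the injections below,
naturality of co-deletion plays this role. -/
theorem sumMap_fst : sumMap f g ≫ fst Y Y' = fst X X' ≫ f := toObj_injective <| by
  simp only [toObj_comp, toObj_sumMap, toObj_fst, Category.assoc, Iso.hom_inv_id_assoc]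
  rw [← id_tensorHom, tensorHom_comp_tensorHom_assoc, toObj_del]
  simp [MonoidalCategory.tensorHom_def']

theorem sumMap_snd : sumMap f g ≫ snd Y Y' = snd X X' ≫ g := toObj_injective <| by
  simp only [toObj_comp, toObj_sumMap, toObj_snd, Category.assoc, Iso.hom_inv_id_assoc]
  rw [← tensorHom_id, tensorHom_comp_tensorHom_assoc, toObj_del]
  simp [MonoidalCategory.tensorHom_def]

theorem inl_sumMap : inl X X' ≫ sumMap f g = f ≫ inl Y Y' := toObj_injective <| by
  simp only [toObj_comp, toObj_sumMap, toObj_inl, Category.assoc, Iso.hom_inv_id_assoc]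
  rw [← id_tensorHom, tensorHom_comp_tensorHom_assoc, gen_toObj]
  simp [MonoidalCategory.tensorHom_def]

theorem inr_sumMap : inr X X' ≫ sumMap f g = g ≫ inr Y Y' := toObj_injective <| by
  simp only [toObj_comp, toObj_sumMap, toObj_inr, Category.assoc, Iso.hom_inv_id_assoc]
  rw [← tensorHom_id, tensorHom_comp_tensorHom_assoc, gen_toObj]
  simp [MonoidalCategory.tensorHom_def']

end maps

theorem diag_fst : diag X ≫ fst X X = 𝟙 X := toObj_injective <| by
  simp [toObj_comp, toObj_diag, toObj_fst, toObj_id, reassoc_of% dup_del]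

theorem diag_snd : diag X ≫ snd X X = 𝟙 X := toObj_injective <| by
  simp [toObj_comp, toObj_diag, toObj_snd, toObj_id, reassoc_of% del_dup]

theorem inl_codiag : inl X X ≫ codiag X = 𝟙 X := toObj_injective <| by
  simp [toObj_comp, toObj_codiag, toObj_inl, toObj_id, fuse_gen]

theorem inr_codiag : inr X X ≫ codiag X = 𝟙 X := toObj_injective <| by
  simp [toObj_comp, toObj_codiag, toObj_inr, toObj_id, gen_fuse]

theorem diag_sumMap_fst_snd : diag (sum X Y) ≫ sumMap (fst X Y) (snd X Y) = 𝟙 _ :=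
  toObj_injective <| by
    simp only [toObj_comp, toObj_diag, toObj_sumMap, Category.assoc, Iso.hom_inv_id_assoc,
      toObj_fst, toObj_snd]
    have h : dup S (sum X Y).n ≫
        (((sumIso X Y).inv ≫ of S (rights X.n) ◁ del S Y.n ≫ (ρ_ _).hom) ⊗ₘ
          ((sumIso X Y).inv ≫ del S X.n ▷ of S (rights Y.n) ≫ (λ_ _).hom)) = (sumIso X Y).inv :=
      dup_fst_snd X.n Y.n
    rw [reassoc_of% h, Iso.inv_hom_id, toObj_id]

theorem sumMap_inl_inr_codiag : sumMap (inl X Y) (inr X Y) ≫ codiag (sum X Y) = 𝟙 _ :=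
  toObj_injective <| by
    simp only [toObj_comp, toObj_codiag, toObj_sumMap, Category.assoc, Iso.hom_inv_id_assoc,
      toObj_inl, toObj_inr]
    have h : (((ρ_ _).inv ≫ of S (rights X.n) ◁ gen S Y.n ≫ (sumIso X Y).hom) ⊗ₘ
        ((λ_ _).inv ≫ gen S X.n ▷ of S (rights Y.n) ≫ (sumIso X Y).hom)) ≫ fuse S (sum X Y).n =
          (sumIso X Y).hom := inl_inr_fuse X.n Y.n
    rw [h, Iso.inv_hom_id, toObj_id]

variable {X Y}

/-- Uniqueness of pairings: naturality of copying moves `m` in front of the diagonal, and what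
follows it is the identity by `diag_sumMap_fst_snd`. -/
theorem diag_sumMap {T : LR S} (m : T ⟶ sum X Y) :
    diag T ≫ sumMap (m ≫ fst X Y) (m ≫ snd X Y) = m := by
  have h : diag T ≫ sumMap (m ≫ fst X Y) (m ≫ snd X Y) =
      m ≫ diag (sum X Y) ≫ sumMap (fst X Y) (snd X Y) := toObj_injective <| by
    simp only [toObj_comp, toObj_diag, toObj_sumMap, Category.assoc, Iso.hom_inv_id_assoc,
      ← tensorHom_comp_tensorHom]
    rw [← reassoc_of% toObj_dup m]
  rw [h, diag_sumMap_fst_snd, Category.comp_id]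

/-- Uniqueness of copairings, dually, by naturality of merging. -/
theorem sumMap_codiag {T : LR S} (m : sum X Y ⟶ T) :
    sumMap (inl X Y ≫ m) (inr X Y ≫ m) ≫ codiag T = m := by
  have h : sumMap (inl X Y ≫ m) (inr X Y ≫ m) ≫ codiag T =
      (sumMap (inl X Y) (inr X Y) ≫ codiag (sum X Y)) ≫ m := toObj_injective <| by
    simp only [toObj_comp, toObj_codiag, toObj_sumMap, Category.assoc, Iso.hom_inv_id_assoc,
      ← tensorHom_comp_tensorHom]
    rw [fuse_toObj m]
  rw [h, sumMap_inl_inr_codiag, Category.id_comp]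

/-- The monoidal product is a product. -/
def isLimit (X Y : LR S) : IsLimit (BinaryFan.mk (fst X Y) (snd X Y)) :=
  BinaryFan.IsLimit.mk _ (fun {T} f g => diag T ≫ sumMap f g)
    (fun {T} f g => by
      change (diag T ≫ sumMap f g) ≫ fst X Y = f
      rw [Category.assoc, sumMap_fst, ← Category.assoc, diag_fst, Category.id_comp])
    (fun {T} f g => by
      change (diag T ≫ sumMap f g) ≫ snd X Y = g
      rw [Category.assoc, sumMap_snd, ← Category.assoc, diag_snd, Category.id_comp])
    (fun {T} f g m h h' => by
      subst h h'
      exact (diag_sumMap m).symm)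

/-- The monoidal product is a coproduct. -/
def isColimit (X Y : LR S) : IsColimit (BinaryCofan.mk (inl X Y) (inr X Y)) :=
  BinaryCofan.IsColimit.mk _ (fun {T} f g => sumMap f g ≫ codiag T)
    (fun {T} f g => by
      change inl X Y ≫ sumMap f g ≫ codiag T = f
      rw [← Category.assoc, inl_sumMap, Category.assoc, inl_codiag, Category.comp_id])
    (fun {T} f g => by
      change inr X Y ≫ sumMap f g ≫ codiag T = g
      rw [← Category.assoc, inr_sumMap, Category.assoc, inr_codiag, Category.comp_id])
    (fun {T} f g m h h' => by
      subst h h'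
      exact (sumMap_codiag m).symm)

end LR

end KDA

theorem mainTheorem4 (S : Type*) :
    -- (cpy), (del), (co-cpy), (co-del)
    (∀ (m n : ℕ) (d : KDA.Diag S (KDA.rights m) (KDA.rights n)), d.IsAutomaton →
      KDA.Diag.Eqv (d ⨾ KDA.Diag.copyN n) (KDA.Diag.copyN m ⨾ (d ⊞ d)) ∧
      KDA.Diag.Eqv (d ⨾ KDA.Diag.deleteN n) (KDA.Diag.deleteN m) ∧
      KDA.Diag.Eqv (KDA.Diag.mergeN m ⨾ d) ((d ⊞ d) ⨾ KDA.Diag.mergeN n) ∧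
      KDA.Diag.Eqv (KDA.Diag.generateN m ⨾ d) (KDA.Diag.generateN n)) ∧
    -- the monoidal product is a biproduct on left-to-right automaton-diagrams
    (∃ _ : HasZeroMorphisms (KDA.LR S),
      IsZero (⟨0⟩ : KDA.LR S) ∧
      (∀ X Y : KDA.LR S,
        ∃ (h₁ : KDA.LR.inl X Y ≫ KDA.LR.fst X Y = 𝟙 X)
          (h₂ : KDA.LR.inl X Y ≫ KDA.LR.snd X Y = 0)
          (h₃ : KDA.LR.inr X Y ≫ KDA.LR.fst X Y = 0)
          (h₄ : KDA.LR.inr X Y ≫ KDA.LR.snd X Y = 𝟙 Y),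
          Nonempty (BinaryBicone.IsBilimit
            { pt := KDA.LR.sum X Y
              fst := KDA.LR.fst X Y
              snd := KDA.LR.snd X Y
              inl := KDA.LR.inl X Y
              inr := KDA.LR.inr X Y
              inl_fst := h₁
              inl_snd := h₂
              inr_fst := h₃
              inr_snd := h₄ })) ∧
      (∀ (X Y X' Y' : KDA.LR S) (f : X ⟶ Y) (g : X' ⟶ Y'),
        KDA.LR.sumMap f g ≫ KDA.LR.fst Y Y' = KDA.LR.fst X X' ≫ f ∧
        KDA.LR.sumMap f g ≫ KDA.LR.snd Y Y' = KDA.LR.snd X X' ≫ g ∧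
        KDA.LR.inl X X' ≫ KDA.LR.sumMap f g = f ≫ KDA.LR.inl Y Y' ∧
        KDA.LR.inr X X' ≫ KDA.LR.sumMap f g = g ≫ KDA.LR.inr Y Y')) := by
  open KDA KDA.Obj in
  refine ⟨fun m n d hd => ⟨mk_eq_iff.1 (comp_copyN d hd), mk_eq_iff.1 (comp_deleteN d hd),
    mk_eq_iff.1 (mergeN_comp d hd), mk_eq_iff.1 (generateN_comp d hd)⟩, LR.hasZeroMorphisms,
    LR.isZero_zero, fun X Y => ⟨LR.inl_fst X Y, LR.inl_snd X Y, LR.inr_fst X Y, LR.inr_snd X Y,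
      ⟨⟨LR.isLimit X Y, LR.isColimit X Y⟩⟩⟩, fun X Y X' Y' f g =>
        ⟨LR.sumMap_fst f g, LR.sumMap_snd f g, LR.inl_sumMap f g, LR.inr_sumMap f g⟩⟩
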